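/- Let $d\ge 2$. There exists a nonempty bounded set $A\subset\mathbb{R}^d$ which is purely unrectifiable, has Hausdorff dimension $d-1$ and box-counting dimension $d-1$, and is not tube null. Here: - $A$ is purely unrectifiable if $\mathcal{H}^1(A\cap\gamma(\mathbb{R}))=0$ for every Lipschitz map $\gamma:\mathbb{R}\to\mathbb{R}^d$, where $\mathcal{H}^1$ is one-dimensional Hausdorff measure (length). - $A$ has box-counting dimension $s$ if $\lim_{r\downarrow 0}\log N(A,r)/\log(1/r)=s$, where $N(A,r)$ is the least number of closed balls of radius $r$ that cover $A$ (in particular, the limit exists). - A tube $T$ of width $w(T)>0$ is the $w(T)$-neighbourhood of a line in $\mathbb{R}^d$, and $A$ is tube null if for every $\delta>0$ it can be covered by countably many tubes $\{T_j\}$ with $\sum_j w(T_j)^{d-1}\le\delta$. -/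

import Mathlib

open MeasureTheory Filter Topology
open scoped ENNReal NNReal

/-- `T` is a tube of width `w` in `ℝ^d`: the `w`-neighbourhood (`w > 0`) of some line, a line being
an affine subspace whose direction is one-dimensional. -/
def IsTube {d : ℕ} (w : ℝ) (T : Set (EuclideanSpace ℝ (Fin d))) : Prop :=
  0 < w ∧ ∃ ℓ : AffineSubspace ℝ (EuclideanSpace ℝ (Fin d)),
    Module.finrank ℝ ℓ.direction = 1 ∧ T = Metric.thickening w (ℓ : Set (EuclideanSpace ℝ (Fin d)))

/-- `A ⊆ ℝ^d` is tube null: for every `δ > 0` it is covered by a countable (finite or infinite)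
family of tubes `T i` of widths `w i` with `∑ i, (w i) ^ (d - 1) ≤ δ`. -/
def IsTubeNull {d : ℕ} (A : Set (EuclideanSpace ℝ (Fin d))) : Prop :=
  ∀ δ : ℝ, 0 < δ →
    ∃ (ι : Type) (_ : Countable ι) (T : ι → Set (EuclideanSpace ℝ (Fin d))) (w : ι → ℝ),
      (∀ i, IsTube (w i) (T i)) ∧ A ⊆ ⋃ i, T i ∧
        ∑' i, ENNReal.ofReal (w i ^ (d - 1)) ≤ ENNReal.ofReal δ

/-- `A ⊆ ℝ^d` is purely unrectifiable (with respect to curves): it meets every Lipschitz curve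
in a set of zero length. -/
def IsPurelyUnrectifiable {d : ℕ} (A : Set (EuclideanSpace ℝ (Fin d))) : Prop :=
  ∀ (K : ℝ≥0) (γ : ℝ → EuclideanSpace ℝ (Fin d)), LipschitzWith K γ →
    μH[1] (A ∩ Set.range γ) = 0

/-- The nonempty bounded set `A ⊆ ℝ^d` has box-counting dimension `s`: if `N(r)` is the least
number of closed balls of radius `r` that cover `A` (finite, since `A` is bounded), then
`log N(r) / log (1 / r)` converges to `s` as `r ↓ 0`. In particular the upper and the lower
box-counting dimensions of `A` coincide. -/
def HasBoxDim {d : ℕ} (A : Set (EuclideanSpace ℝ (Fin d))) (s : ℝ) : Prop :=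
  A.Nonempty ∧ Bornology.IsBounded A ∧
    Tendsto (fun r : ℝ≥0 =>
        Real.log ((Metric.externalCoveringNumber r A).toNat : ℝ) / Real.log (1 / (r : ℝ)))
      (𝓝[>] 0) (𝓝 s)

/-! The set is a limit of nested families of grid cubes chosen by a random construction. With `M =
subdiv n = 2 ^ (n + 1)` and `b = blocks d n = 4 * M ^ (d - 1)`, a cube of generation `n` is cut into
`b ^ d` blocks, and every interior block keeps a single subcube, `M` times smaller than the block.
Up to subexponential factors there are `ℓ ^ (d - 1)` cubes of side `1 / ℓ`, which gives the upper
bounds on both dimensions.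

Pure unrectifiability holds for every choice of subcubes: a piece of curve of the size of a block
meets boundedly many blocks, hence boundedly many cubes, which are `M` times smaller, and `M → ∞`.

The choice matters only for tubes. Place on generation `n` a density (a weighted sum of bumps) of
total mass bounded below. Choosing subcubes uniformly at random does not increase the expected
integral along a line, and one cube contributes at most `4 ^ (-n)` to it. Exponential moments and a
union bound over a finite net of lines (`exists_forall_sum_le`, `LineBounded.exists_children`) yield
a choice that is good for all lines at once, with summable errors; hence the uniform bound of
`exists_cubes`. By Fubini a tube of width `w` then has mass `O(w ^ (d - 1))`, so by compactness
tubes covering the limit set have `∑ w ^ (d - 1)` bounded below (`IsRefining.exists_le_tsum`).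

The lower bounds on the dimensions come for free: balls, and sets of small diameter, lie in tubes of
comparable width, so a set that is not tube null cannot be covered too cheaply. -/

/-! ### Exponential moments and finite nets. -/

lemma Real.exp_le_one_add_mul_of_le_one {x c : ℝ} (h0 : 0 ≤ x) (hxc : x ≤ c) (hc : c ≤ 1) :
    Real.exp x ≤ 1 + (1 + c) * x := by
  have h := Real.abs_exp_sub_one_sub_id_le (x := x) (by rw [abs_of_nonneg h0]; linarith)
  have h' := (abs_le.mp h).2
  nlinarith

/-- Exponential moment bound for a sum of independent variables with values in `[0, c]`, where
the `i`-th variable is `a i j` for a uniformly random `j`. -/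
lemma sum_exp_sum_le {ι J : Type*} [Fintype ι] [Fintype J] [Nonempty J] [DecidableEq ι]
    (a : ι → J → ℝ) {c : ℝ} (hc : c ≤ 1) (ha : ∀ i j, 0 ≤ a i j)
    (hac : ∀ i j, a i j ≤ c) :
    ∑ ω : ι → J, Real.exp (∑ i, a i (ω i)) ≤
      (Fintype.card J : ℝ) ^ Fintype.card ι *
        Real.exp ((1 + c) * ∑ i, (∑ j, a i j) / Fintype.card J) := by
  have hJ : (0 : ℝ) < Fintype.card J := by exact_mod_cast Fintype.card_pos
  calc ∑ ω : ι → J, Real.exp (∑ i, a i (ω i))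
      = ∏ i, ∑ j, Real.exp (a i j) := by
        simp_rw [Real.exp_sum]
        rw [Finset.prod_univ_sum, Fintype.piFinset_univ]
    _ ≤ ∏ i, (Fintype.card J * Real.exp ((1 + c) * ((∑ j, a i j) / Fintype.card J))) := by
        refine Finset.prod_le_prod (fun i _ => Finset.sum_nonneg fun j _ => (Real.exp_pos _).le)
          fun i _ => ?_
        calc ∑ j, Real.exp (a i j) ≤ ∑ j, (1 + (1 + c) * a i j) :=
              Finset.sum_le_sum fun j _ =>
                Real.exp_le_one_add_mul_of_le_one (ha i j) (hac i j) hc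
          _ = Fintype.card J * ((1 + c) * ((∑ j, a i j) / Fintype.card J) + 1) := by
              rw [Finset.sum_add_distrib, ← Finset.mul_sum]
              simp
              field_simp
              ring
          _ ≤ _ := by gcongr; exact Real.add_one_le_exp _
    _ = _ := by
        rw [Finset.prod_mul_distrib, ← Real.exp_sum, ← Finset.mul_sum]
        simp

/-- Simultaneous one-sided concentration for finitely many sums of independent variables. -/
lemma exists_forall_sum_le {ι J Λ : Type*} [Fintype ι] [Fintype J] [Nonempty J] [Fintype Λ]
    [Nonempty Λ] (a : Λ → ι → J → ℝ) (y : Λ → ℝ) {η θ : ℝ} (hη : 0 ≤ η) (hθ : 0 < θ)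
    (hθη : θ * η ≤ 1) (ha : ∀ l i j, 0 ≤ a l i j) (haη : ∀ l i j, a l i j ≤ η)
    (hy : ∀ l, ∑ i, (∑ j, a l i j) / Fintype.card J ≤ y l) :
    ∃ ω : ι → J, ∀ l, ∑ i, a l i (ω i) ≤
      (1 + θ * η) * y l + Real.log (Fintype.card Λ) / θ := by
  classical
  have hJ : (0 : ℝ) < Fintype.card J := by exact_mod_cast Fintype.card_pos
  have hΛ : (0 : ℝ) < Fintype.card Λ := by exact_mod_cast Fintype.card_pos
  have key : ∀ l, ∑ ω : ι → J, Real.exp (∑ i, θ * a l i (ω i) - (1 + θ * η) * (θ * y l)) ≤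
      (Fintype.card J : ℝ) ^ Fintype.card ι := by
    intro l
    have h := sum_exp_sum_le (fun i j => θ * a l i j) (c := θ * η) hθη
      (fun i j => mul_nonneg hθ.le (ha l i j))
      (fun i j => mul_le_mul_of_nonneg_left (haη l i j) hθ.le)
    simp_rw [Real.exp_sub, ← Finset.sum_div]
    rw [div_le_iff₀ (Real.exp_pos _)]
    refine h.trans ?_
    gcongr
    simp_rw [← Finset.mul_sum, mul_div_assoc, ← Finset.mul_sum]
    exact mul_le_mul_of_nonneg_left (hy l) hθ.le
  -- Each normalised exponential has mean at most `1`, so some `ω` makes their sum over `l` at most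
  -- `card Λ`. Every single term is then at most `card Λ`, and taking logarithms gives the bound.
  obtain ⟨ω, -, hω⟩ := Finset.exists_le_of_sum_le (s := (Finset.univ : Finset (ι → J)))
    (f := fun ω => ∑ l, Real.exp (∑ i, θ * a l i (ω i) - (1 + θ * η) * (θ * y l)))
    (g := fun _ => (Fintype.card Λ : ℝ)) Finset.univ_nonempty (by
      rw [Finset.sum_comm]
      refine (Finset.sum_le_sum fun l _ => key l).trans ?_
      simp [mul_comm])
  refine ⟨ω, fun l => ?_⟩
  have h1 : Real.exp (∑ i, θ * a l i (ω i) - (1 + θ * η) * (θ * y l)) ≤ Fintype.card Λ :=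
    (Finset.single_le_sum (f := fun l => Real.exp (∑ i, θ * a l i (ω i) -
      (1 + θ * η) * (θ * y l))) (fun l _ => (Real.exp_pos _).le) (Finset.mem_univ l)).trans hω
  rw [← Real.le_log_iff_exp_le hΛ, ← Finset.mul_sum] at h1
  rw [← sub_le_iff_le_add', le_div_iff₀ hθ]
  linarith

/-- A subset of the unit ball of `ι → ℝ` has a `G⁻¹`-net of at most `(2 G + 1) ^ card ι`
points that lie in the subset. -/
lemma exists_net {ι : Type*} [Fintype ι] (S : Set (ι → ℝ)) (hS : ∀ x ∈ S, ‖x‖ ≤ 1)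
    {G : ℕ} (hG : 0 < G) :
    ∃ F : Finset (ι → ℝ), (∀ x ∈ F, x ∈ S) ∧ F.card ≤ (2 * G + 1) ^ Fintype.card ι ∧
      ∀ x ∈ S, ∃ y ∈ F, ‖x - y‖ ≤ (G : ℝ)⁻¹ := by
  classical
  let code : (ι → ℝ) → ι → ℤ := fun x i => ⌊x i * G⌋
  have hG' : (0 : ℝ) < G := by exact_mod_cast hG
  let K : Finset (ι → ℤ) := Fintype.piFinset fun _ => Finset.Icc (-(G : ℤ)) G
  have hcode : ∀ x ∈ S, code x ∈ K := by
    intro x hx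
    simp only [K, Fintype.mem_piFinset, Finset.mem_Icc, code]
    intro i
    have h := abs_le.mp ((norm_le_pi_norm x i).trans (hS x hx))
    constructor
    · rw [Int.le_floor]; push_cast; nlinarith
    · have : (⌊x i * G⌋ : ℝ) ≤ G := (Int.floor_le _).trans (by nlinarith)
      exact_mod_cast this
  -- Representatives are taken in `S` itself rather than on the grid, because the line bounds are
  -- only available for genuine pairs (point, unit direction). The value `0` for unused codes is
  -- filtered out.
  let rep : (ι → ℤ) → (ι → ℝ) := fun k =>
    if h : ∃ x ∈ S, code x = k then h.choose else 0
  have hrep : ∀ x ∈ S, rep (code x) ∈ S ∧ code (rep (code x)) = code x := by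
    intro x hx
    have h : ∃ z ∈ S, code z = code x := ⟨x, hx, rfl⟩
    simp only [rep, dif_pos h]
    exact h.choose_spec
  refine ⟨(K.image rep).filter (· ∈ S), fun x hx => (Finset.mem_filter.mp hx).2, ?_, ?_⟩
  · refine (Finset.card_filter_le _ _).trans (Finset.card_image_le.trans ?_)
    simp [K, Fintype.card_piFinset]
    gcongr
    omega
  · intro x hx
    refine ⟨rep (code x), Finset.mem_filter.mpr
      ⟨Finset.mem_image_of_mem _ (hcode x hx), (hrep x hx).1⟩, ?_⟩
    rw [pi_norm_le_iff_of_nonneg (by positivity)]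
    intro i
    have h : ⌊rep (code x) i * G⌋ = ⌊x i * G⌋ := congrFun (hrep x hx).2 i
    have h' := Int.abs_sub_lt_one_of_floor_eq_floor h
    rw [Pi.sub_apply, Real.norm_eq_abs, abs_sub_comm, ← one_div, le_div_iff₀ hG',
      ← abs_of_pos hG', ← abs_mul, sub_mul]
    exact h'.le

/-! ### Grid cubes and their bumps. -/

/-- The centre of the grid cube of side `1 / ℓ` with integer corner `k`. -/
noncomputable def gridCenter {d : ℕ} (ℓ : ℕ) (k : Fin d → ℕ) : Fin d → ℝ :=
  fun i => (k i + 1 / 2) / ℓ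

/-- A Lipschitz bump on the grid cube of side `1 / ℓ` with corner `k`: it is supported in the cube
and equal to `1` at distance at least `1 / (ℓ b)` from the boundary. -/
noncomputable def gridBump {d : ℕ} (ℓ b : ℕ) (k : Fin d → ℕ) (x : Fin d → ℝ) : ℝ :=
  max 0 (min 1 ((1 / 2 - ℓ * ‖x - gridCenter ℓ k‖) * b))

/-- The corner of the subcube number `j` of the (interior) block number `β` of the cube with
corner `k`, when cubes are cut into `b ^ d` blocks and blocks into `M ^ d` subcubes. -/
def childCorner {d : ℕ} (b M : ℕ) (k : Fin d → ℕ) (β : Fin d → Fin (b - 2)) (j : Fin d → Fin M) :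
    Fin d → ℕ :=
  fun l => (b * k l + (β l + 1)) * M + j l

section
variable {d : ℕ} {ℓ b M : ℕ} {k : Fin d → ℕ} {x y : Fin d → ℝ}

lemma gridBump_nonneg : 0 ≤ gridBump ℓ b k x := le_max_left _ _

lemma gridBump_le_one : gridBump ℓ b k x ≤ 1 := max_le zero_le_one (min_le_left _ _)

lemma continuous_gridBump : Continuous (gridBump ℓ b k) := by
  unfold gridBump; fun_prop

lemma abs_gridBump_sub_le : |gridBump ℓ b k x - gridBump ℓ b k y| ≤ ℓ * b * ‖x - y‖ := by
  unfold gridBump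
  refine (abs_max_sub_max_le_max _ _ _ _).trans (max_le (by simp; positivity) ?_)
  refine (abs_min_sub_min_le_max _ _ _ _).trans (max_le (by simp; positivity) ?_)
  rw [← sub_mul, sub_sub_sub_cancel_left, ← mul_sub, abs_mul, abs_mul, Nat.abs_cast, Nat.abs_cast]
  have h := abs_norm_sub_norm_le (y - gridCenter ℓ k) (x - gridCenter ℓ k)
  rw [sub_sub_sub_cancel_right, norm_sub_rev y x] at h
  calc _ = ℓ * b * |‖y - gridCenter ℓ k‖ - ‖x - gridCenter ℓ k‖| := by ring
    _ ≤ _ := by gcongr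

lemma norm_sub_gridCenter_lt (h : gridBump ℓ b k x ≠ 0) : ℓ * ‖x - gridCenter ℓ k‖ < 1 / 2 := by
  by_contra! hx
  refine h (max_eq_left ((min_le_right _ _).trans ?_))
  exact mul_nonpos_of_nonpos_of_nonneg (by linarith) (Nat.cast_nonneg b)

lemma mul_sub_gridCenter (hℓ : 0 < ℓ) (i : Fin d) :
    ℓ * (x - gridCenter ℓ k) i = ℓ * x i - k i - 1 / 2 := by
  have : (ℓ : ℝ) ≠ 0 := by positivity
  simp only [Pi.sub_apply, gridCenter]
  field_simp
  ring

lemma mul_mem_of_gridBump_ne_zero (hℓ : 0 < ℓ) (h : gridBump ℓ b k x ≠ 0) (i : Fin d) :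
    k i < ℓ * x i ∧ ℓ * x i < k i + 1 := by
  have h1 := norm_sub_gridCenter_lt h
  have h2 : |ℓ * (x - gridCenter ℓ k) i| < 1 / 2 := by
    rw [abs_mul, Nat.abs_cast]
    exact (mul_le_mul_of_nonneg_left (norm_le_pi_norm (x - gridCenter ℓ k) i)
      (Nat.cast_nonneg ℓ)).trans_lt h1
  rw [mul_sub_gridCenter hℓ, abs_lt] at h2
  constructor <;> linarith

lemma gridBump_eq_one (hℓ : 0 < ℓ) (hb : 2 ≤ b)
    (h : ∀ i, k i + 1 / (b : ℝ) ≤ ℓ * x i ∧ ℓ * x i ≤ k i + 1 - 1 / b) :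
    gridBump ℓ b k x = 1 := by
  have hb' : (2 : ℝ) ≤ b := by exact_mod_cast hb
  have hℓ' : (0 : ℝ) < ℓ := by exact_mod_cast hℓ
  have hb1 : 1 / (b : ℝ) ≤ 1 / 2 := one_div_le_one_div_of_le (by norm_num) hb'
  have h1 : ‖x - gridCenter ℓ k‖ ≤ (1 / 2 - 1 / b) / ℓ := by
    rw [pi_norm_le_iff_of_nonneg (div_nonneg (by linarith) hℓ'.le)]
    intro i
    rw [le_div_iff₀ hℓ', Real.norm_eq_abs, mul_comm, ← abs_of_pos hℓ', ← abs_mul,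
      mul_sub_gridCenter hℓ, abs_le]
    constructor <;> linarith [(h i).1, (h i).2]
  rw [le_div_iff₀ hℓ', mul_comm] at h1
  have h2 : 1 ≤ (1 / 2 - ℓ * ‖x - gridCenter ℓ k‖) * b := by
    calc (1 : ℝ) = 1 / b * b := by field_simp
      _ ≤ _ := by gcongr; linarith
  rw [gridBump, min_eq_left h2, max_eq_right zero_le_one]

lemma childCorner_div (hM : 0 < M) (β : Fin d → Fin (b - 2)) (j : Fin d → Fin M) (l : Fin d) :
    childCorner b M k β j l / M = b * k l + (β l + 1) := by
  rw [childCorner, mul_comm, Nat.mul_add_div hM, Nat.div_eq_of_lt (j l).2, add_zero]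

lemma childCorner_mod (β : Fin d → Fin (b - 2)) (j : Fin d → Fin M) (l : Fin d) :
    childCorner b M k β j l % M = j l := by
  rw [childCorner, mul_comm, Nat.mul_add_mod, Nat.mod_eq_of_lt (j l).2]

lemma block_div (hb : 2 ≤ b) (β : Fin d → Fin (b - 2)) (l : Fin d) :
    (b * k l + (β l + 1)) / b = k l := by
  have := (β l).2
  rw [Nat.mul_add_div (by omega), Nat.div_eq_of_lt (by omega), add_zero]

lemma childCorner_injective (hM : 0 < M) {β β' : Fin d → Fin (b - 2)} {j j' : Fin d → Fin M}
    (h : childCorner b M k β j = childCorner b M k β' j') : β = β' ∧ j = j' := by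
  constructor <;> ext l
  · have h1 := childCorner_div (k := k) hM β j l
    rw [h, childCorner_div hM] at h1
    omega
  · rw [← childCorner_mod (k := k) β j l, h, childCorner_mod]

/-- This is why only interior blocks are used: on them the bump of the parent is identically `1`,
while the bumps of distinct subcubes have disjoint supports and are at most `1`. -/
lemma sum_gridBump_childCorner_le (hℓ : 0 < ℓ) (hb : 2 ≤ b) (hM : 0 < M) (b' : ℕ) :
    ∑ β, ∑ j, gridBump (ℓ * (b * M)) b' (childCorner b M k β j) x ≤ gridBump ℓ b k x := by
  classical
  rw [← Fintype.sum_prod_type']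
  by_cases h : ∀ q : (Fin d → Fin (b - 2)) × (Fin d → Fin M),
      gridBump (ℓ * (b * M)) b' (childCorner b M k q.1 q.2) x = 0
  · rw [Finset.sum_eq_zero fun q _ => h q]
    exact gridBump_nonneg
  push Not at h
  obtain ⟨q, hq⟩ := h
  have hℓ' : 0 < ℓ * (b * M) := by positivity
  have hbR : (0 : ℝ) < b := by positivity
  have hMR : (0 : ℝ) < M := by exact_mod_cast hM
  have hx := mul_mem_of_gridBump_ne_zero hℓ' hq
  rw [Finset.sum_eq_single q ?_ (by simp), gridBump_eq_one hℓ hb]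
  · exact gridBump_le_one
  · intro i
    obtain ⟨h1, h2⟩ := hx i
    simp only [childCorner] at h1 h2
    push_cast at h1 h2
    have hj : ((q.2 i : ℕ) : ℝ) + 1 ≤ M := by exact_mod_cast (q.2 i).2
    have hβ : ((q.1 i : ℕ) : ℝ) + 3 ≤ b := by
      have := (q.1 i).2
      exact_mod_cast (by omega : (q.1 i : ℕ) + 3 ≤ b)
    have hj0 : (0 : ℝ) ≤ (q.2 i : ℕ) := Nat.cast_nonneg _
    have hβ0 : (0 : ℝ) ≤ (q.1 i : ℕ) := Nat.cast_nonneg _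
    have h3 : (b * k i + 1 : ℝ) ≤ ℓ * x i * b := by
      refine le_of_mul_le_mul_right ?_ hMR
      nlinarith
    have h4 : ℓ * x i * b ≤ (b * k i + b - 1 : ℝ) := by
      refine le_of_mul_le_mul_right ?_ hMR
      nlinarith
    constructor
    · refine le_of_mul_le_mul_right ?_ hbR
      calc _ = (b * k i + 1 : ℝ) := by field_simp
        _ ≤ _ := h3
    · refine le_of_mul_le_mul_right ?_ hbR
      calc _ ≤ (b * k i + b - 1 : ℝ) := h4
        _ = _ := by field_simp
  · intro q' _ hne
    by_contra hq'
    apply hne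
    have hx' := mul_mem_of_gridBump_ne_zero hℓ' hq'
    have : childCorner b M k q'.1 q'.2 = childCorner b M k q.1 q.2 := by
      ext i
      have h1 : (childCorner b M k q'.1 q'.2 i : ℝ) < childCorner b M k q.1 q.2 i + 1 :=
        (hx' i).1.trans (hx i).2
      have h2 : (childCorner b M k q.1 q.2 i : ℝ) < childCorner b M k q'.1 q'.2 i + 1 :=
        (hx i).1.trans (hx' i).2
      have h1' : childCorner b M k q'.1 q'.2 i < childCorner b M k q.1 q.2 i + 1 := by
        exact_mod_cast h1
      have h2' : childCorner b M k q.1 q.2 i < childCorner b M k q'.1 q'.2 i + 1 := by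
        exact_mod_cast h2
      omega
    exact Prod.ext (childCorner_injective hM this).1 (childCorner_injective hM this).2

lemma exists_abs_eq_one_of_norm_eq_one {v : Fin d → ℝ} (hv : ‖v‖ = 1) : ∃ i, |v i| = 1 := by
  by_contra! h
  have : ‖v‖ < 1 := (pi_norm_lt_iff one_pos).mpr fun i =>
    lt_of_le_of_ne ((norm_le_pi_norm v i).trans hv.le) (h i)
  exact this.ne hv

/-- A sup-norm unit vector has a coordinate `±1`, and in that coordinate the support of the bump has
width `1 / ℓ`. -/
lemma intervalIntegral_gridBump_le (hℓ : 0 < ℓ) (p : Fin d → ℝ) {v : Fin d → ℝ} (hv : ‖v‖ = 1) :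
    ∫ t in (-1 : ℝ)..1, gridBump ℓ b k (p + t • v) ≤ 1 / ℓ := by
  have hℓ' : (0 : ℝ) < ℓ := by exact_mod_cast hℓ
  obtain ⟨i, hi⟩ := exists_abs_eq_one_of_norm_eq_one hv
  have hvi : v i * v i = 1 := by rw [← abs_mul_abs_self, hi, one_mul]
  set t₀ : ℝ := (gridCenter ℓ k i - p i) * v i
  have hle : ∀ t, gridBump ℓ b k (p + t • v) ≤
      (Set.Icc (t₀ - 1 / (2 * ℓ)) (t₀ + 1 / (2 * ℓ))).indicator 1 t := by
    intro t
    by_cases h0 : gridBump ℓ b k (p + t • v) = 0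
    · rw [h0]; exact Set.indicator_nonneg (fun _ _ => zero_le_one) _
    rw [Set.indicator_of_mem]
    · exact gridBump_le_one
    have h1 := norm_sub_gridCenter_lt h0
    have h2 : |t - t₀| ≤ ‖p + t • v - gridCenter ℓ k‖ := by
      refine le_trans (le_of_eq ?_) (norm_le_pi_norm _ i)
      rw [Real.norm_eq_abs]
      calc |t - t₀| = |v i| * |t - t₀| := by rw [hi, one_mul]
        _ = _ := by
          rw [← abs_mul]
          congr 1
          simp [t₀]
          linear_combination (p i - gridCenter ℓ k i) * hvi
    have h3 : |t - t₀| ≤ 1 / (2 * ℓ) := by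
      rw [le_div_iff₀ (by positivity)]
      nlinarith
    rw [abs_le] at h3
    constructor <;> linarith
  rw [intervalIntegral.integral_of_le (by norm_num)]
  calc ∫ t in Set.Ioc (-1 : ℝ) 1, gridBump ℓ b k (p + t • v)
      ≤ ∫ t in Set.Ioc (-1 : ℝ) 1,
        (Set.Icc (t₀ - 1 / (2 * ℓ)) (t₀ + 1 / (2 * ℓ))).indicator (1 : ℝ → ℝ) t := by
        refine integral_mono ?_ ?_ hle
        · have : Continuous fun t : ℝ => gridBump ℓ b k (p + t • v) :=
            continuous_gridBump.comp (by fun_prop)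
          exact (this.integrableOn_Icc).mono_set Set.Ioc_subset_Icc_self
        · exact (integrable_indicator_iff measurableSet_Icc).mpr
            (integrableOn_const (by
              exact ((measure_mono (Set.subset_univ _)).trans_lt (by simp)).ne))
    _ ≤ ∫ t, (Set.Icc (t₀ - 1 / (2 * ℓ)) (t₀ + 1 / (2 * ℓ))).indicator (1 : ℝ → ℝ) t := by
        refine setIntegral_le_integral ?_ (ae_of_all _ fun t =>
          Set.indicator_nonneg (fun _ _ => zero_le_one) _)
        exact (integrable_indicator_iff measurableSet_Icc).mpr (integrableOn_const (by simp))
    _ = 1 / ℓ := by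
        rw [integral_indicator_one measurableSet_Icc]
        simp [Measure.real]
        ring

end

/-! ### Line integrals of densities and one random refinement. -/

/-- The total of the bumps on a finite family of grid cubes, with weight `D`. -/
noncomputable def gridDensity {d : ℕ} {ι : Type*} [Fintype ι] (D ℓ b : ℕ) (k : ι → Fin d → ℕ)
    (x : Fin d → ℝ) : ℝ :=
  D * ∑ i, gridBump ℓ b (k i) x

/-- All integrals of `g` along (sup-norm) unit speed segments `[-1, 1] → ℝ^d` centred in the unit
cube are at most `U`. -/
def LineBounded {d : ℕ} (g : (Fin d → ℝ) → ℝ) (U : ℝ) : Prop :=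
  ∀ p : Fin d → ℝ, (∀ i, p i ∈ Set.Icc (0 : ℝ) 1) → ∀ v : Fin d → ℝ, ‖v‖ = 1 →
    ∫ t in (-1 : ℝ)..1, g (p + t • v) ≤ U

section
variable {d : ℕ} {ι : Type*} [Fintype ι] {D ℓ b M : ℕ} {k : ι → Fin d → ℕ}

lemma gridDensity_nonneg (x : Fin d → ℝ) : 0 ≤ gridDensity D ℓ b k x :=
  mul_nonneg (Nat.cast_nonneg _) (Finset.sum_nonneg fun _ _ => gridBump_nonneg)

lemma continuous_gridDensity : Continuous (gridDensity D ℓ b k) :=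
  continuous_const.mul (continuous_finsetSum _ fun _ _ => continuous_gridBump)

lemma abs_gridDensity_sub_le (x y : Fin d → ℝ) :
    |gridDensity D ℓ b k x - gridDensity D ℓ b k y| ≤
      D * Fintype.card ι * (ℓ * b) * ‖x - y‖ := by
  rw [gridDensity, gridDensity, ← mul_sub, ← Finset.sum_sub_distrib, abs_mul, Nat.abs_cast,
    mul_assoc, mul_assoc]
  gcongr
  refine (Finset.abs_sum_le_sum_abs _ _).trans
    ((Finset.sum_le_sum fun i _ => abs_gridBump_sub_le).trans ?_)
  simp [mul_assoc]

lemma continuous_comp_line {g : (Fin d → ℝ) → ℝ} (hg : Continuous g) (p v : Fin d → ℝ) :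
    Continuous fun t : ℝ => g (p + t • v) :=
  hg.comp (by fun_prop)

lemma intervalIntegral_gridDensity (p v : Fin d → ℝ) :
    ∫ t in (-1 : ℝ)..1, gridDensity D ℓ b k (p + t • v) =
      ∑ i, D * ∫ t in (-1 : ℝ)..1, gridBump ℓ b (k i) (p + t • v) := by
  unfold gridDensity
  rw [intervalIntegral.integral_const_mul, intervalIntegral.integral_finsetSum, Finset.mul_sum]
  exact fun i _ => (continuous_comp_line continuous_gridBump p v).intervalIntegrable _ _

/-- Moving `p` and `v` by `1 / G` moves the points with `|t| ≤ 1` by at most `2 / G`; integrating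
over an interval of length `2` gives the error `K * (4 / G)`. -/
lemma LineBounded.of_net {g : (Fin d → ℝ) → ℝ} (hg : Continuous g) {K V : ℝ} {G : ℕ}
    (hK : 0 ≤ K) (hgK : ∀ x y, |g x - g y| ≤ K * ‖x - y‖)
    (F : Finset (Fin d ⊕ Fin d → ℝ))
    (hF : ∀ p : Fin d → ℝ, (∀ i, p i ∈ Set.Icc (0 : ℝ) 1) → ∀ v : Fin d → ℝ, ‖v‖ = 1 →
      ∃ y ∈ F, ‖Sum.elim p v - y‖ ≤ (G : ℝ)⁻¹)
    (hV : ∀ y ∈ F, ∫ t in (-1 : ℝ)..1, g (y ∘ Sum.inl + t • (y ∘ Sum.inr)) ≤ V) :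
    LineBounded g (V + K * (4 / G)) := by
  intro p hp v hv
  obtain ⟨y, hyF, hy⟩ := hF p hp v hv
  have hG : (0 : ℝ) ≤ (G : ℝ)⁻¹ := by positivity
  have h1 : ‖p - y ∘ Sum.inl‖ ≤ (G : ℝ)⁻¹ := by
    rw [pi_norm_le_iff_of_nonneg hG]
    exact fun i => (norm_le_pi_norm (Sum.elim p v - y) (Sum.inl i)).trans hy
  have h2 : ‖v - y ∘ Sum.inr‖ ≤ (G : ℝ)⁻¹ := by
    rw [pi_norm_le_iff_of_nonneg hG]
    exact fun i => (norm_le_pi_norm (Sum.elim p v - y) (Sum.inr i)).trans hy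
  have h3 : ∫ t in (-1 : ℝ)..1, g (p + t • v) ≤
      ∫ t in (-1 : ℝ)..1, (g (y ∘ Sum.inl + t • (y ∘ Sum.inr)) + K * (2 * (G : ℝ)⁻¹)) := by
    refine intervalIntegral.integral_mono_on (by norm_num)
      ((continuous_comp_line hg p v).intervalIntegrable _ _)
      (((continuous_comp_line hg _ _).add continuous_const).intervalIntegrable _ _) ?_
    intro t ht
    have h4 := (le_abs_self _).trans (hgK (p + t • v) (y ∘ Sum.inl + t • (y ∘ Sum.inr)))
    have h5 : ‖p + t • v - (y ∘ Sum.inl + t • (y ∘ Sum.inr))‖ ≤ 2 * (G : ℝ)⁻¹ := by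
      calc _ = ‖(p - y ∘ Sum.inl) + t • (v - y ∘ Sum.inr)‖ := by congr 1; module
        _ ≤ ‖p - y ∘ Sum.inl‖ + |t| * ‖v - y ∘ Sum.inr‖ := by
            refine (norm_add_le _ _).trans ?_
            rw [norm_smul, Real.norm_eq_abs]
        _ ≤ (G : ℝ)⁻¹ + 1 * (G : ℝ)⁻¹ := by
            gcongr
            exact abs_le.mpr ht
        _ = _ := by ring
    have h6 := mul_le_mul_of_nonneg_left h5 hK
    linarith
  rw [intervalIntegral.integral_add ((continuous_comp_line hg _ _).intervalIntegrable _ _)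
    (continuous_const.intervalIntegrable _ _), intervalIntegral.integral_const] at h3
  refine h3.trans (add_le_add (hV y hyF) (le_of_eq ?_))
  simp only [smul_eq_mul]
  ring

/-- One refinement step: every interior block of every cube keeps one of its `M ^ d` subcubes, in
such a way that all line integrals of the renormalised density remain under control. -/
lemma LineBounded.exists_children (hℓ : 0 < ℓ) (hb : 2 ≤ b) (hM : 0 < M) {U : ℝ}
    (hU : LineBounded (gridDensity D ℓ b k) U) (b' : ℕ) {G : ℕ} (hG : 0 < G) {θ : ℝ} (hθ : 0 < θ)
    (hθη : θ * ((D * M ^ d : ℕ) / (ℓ * (b * M) : ℕ)) ≤ 1) :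
    ∃ j : ι × (Fin d → Fin (b - 2)) → Fin d → Fin M,
      LineBounded (gridDensity (D * M ^ d) (ℓ * (b * M)) b'
        fun q => childCorner b M (k q.1) q.2 (j q))
      ((1 + θ * ((D * M ^ d : ℕ) / (ℓ * (b * M) : ℕ))) * U +
        2 * d * Real.log (2 * G + 1) / θ +
        ((D * M ^ d : ℕ) * Fintype.card (ι × (Fin d → Fin (b - 2))) *
          ((ℓ * (b * M) : ℕ) * b')) * (4 / G)) := by
  set η : ℝ := (D * M ^ d : ℕ) / (ℓ * (b * M) : ℕ) with hη
  have hη0 : 0 ≤ η := by positivity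
  have : NeZero M := ⟨hM.ne'⟩
  let S : Set (Fin d ⊕ Fin d → ℝ) :=
    {y | (∀ i, y (Sum.inl i) ∈ Set.Icc (0 : ℝ) 1) ∧ ‖y ∘ Sum.inr‖ = 1}
  have hS : ∀ y ∈ S, ‖y‖ ≤ 1 := by
    rintro y ⟨hy1, hy2⟩
    rw [pi_norm_le_iff_of_nonneg zero_le_one]
    rintro (i | i)
    · rw [Real.norm_eq_abs, abs_le]
      exact ⟨by linarith [(hy1 i).1], (hy1 i).2⟩
    · exact (norm_le_pi_norm (y ∘ Sum.inr) i).trans hy2.le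
  obtain ⟨F, hFS, hFcard, hFnet⟩ := exists_net S hS hG
  have hnet : ∀ p : Fin d → ℝ, (∀ i, p i ∈ Set.Icc (0 : ℝ) 1) → ∀ v : Fin d → ℝ, ‖v‖ = 1 →
      ∃ y ∈ F, ‖Sum.elim p v - y‖ ≤ (G : ℝ)⁻¹ :=
    fun p hp v hv => hFnet _ ⟨hp, hv⟩
  have hlogG : 0 ≤ Real.log (2 * G + 1) := Real.log_nonneg (by
    have : (0 : ℝ) ≤ G := Nat.cast_nonneg G
    linarith)
  -- An empty net means that there are no lines to control, and any choice of subcubes will do.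
  by_cases hFe : F.Nonempty
  swap
  · refine ⟨fun _ _ => 0, fun p hp v hv => ?_⟩
    obtain ⟨y, hy, -⟩ := hnet p hp v hv
    exact absurd ⟨y, hy⟩ hFe
  have : Nonempty F := hFe.to_subtype
  let a : F → ι × (Fin d → Fin (b - 2)) → (Fin d → Fin M) → ℝ := fun y q j =>
    (D * M ^ d : ℕ) * ∫ t in (-1 : ℝ)..1, gridBump (ℓ * (b * M)) b'
      (childCorner b M (k q.1) q.2 j) (y.1 ∘ Sum.inl + t • (y.1 ∘ Sum.inr))
  obtain ⟨j, hj⟩ := exists_forall_sum_le a (fun _ => U) hη0 hθ hθη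
    (fun y q j => mul_nonneg (Nat.cast_nonneg _)
      (intervalIntegral.integral_nonneg (by norm_num) fun _ _ => gridBump_nonneg))
    (fun y q j => by
      simp only [a, hη]
      rw [div_eq_mul_one_div]
      gcongr
      exact intervalIntegral_gridBump_le (by positivity) _ (hFS _ y.2).2)
    (fun y => by
      -- Expected line integral: the new weight `M ^ d` cancels the probability `1 / M ^ d` of a
      -- subcube, and all subcubes of a parent together stay below the bump of the parent.
      refine le_trans ?_ (hU _ (hFS _ y.2).1 _ (hFS _ y.2).2)
      rw [intervalIntegral_gridDensity, Fintype.sum_prod_type]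
      refine Finset.sum_le_sum fun i _ => ?_
      simp only [a, ← Finset.mul_sum, ← Finset.sum_div]
      have hcard : (Fintype.card (Fin d → Fin M) : ℝ) = (M : ℝ) ^ d := by simp
      have hMd : (0 : ℝ) < (M : ℝ) ^ d := by positivity
      rw [hcard, div_le_iff₀ hMd, Nat.cast_mul, Nat.cast_pow, mul_right_comm]
      gcongr
      have hint : ∀ (k' : Fin d → ℕ), IntervalIntegrable (fun t : ℝ =>
          gridBump (ℓ * (b * M)) b' k' (y.1 ∘ Sum.inl + t • (y.1 ∘ Sum.inr))) volume (-1) 1 :=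
        fun k' => (continuous_comp_line continuous_gridBump _ _).intervalIntegrable _ _
      simp_rw [← intervalIntegral.integral_finsetSum fun j _ => hint _]
      rw [← intervalIntegral.integral_finsetSum fun β _ => ?_]
      · refine intervalIntegral.integral_mono_on (by norm_num) ?_ ?_
          fun t _ => sum_gridBump_childCorner_le hℓ hb hM b'
        · exact (continuous_finsetSum _ fun β _ => continuous_finsetSum _ fun j _ =>
            continuous_comp_line continuous_gridBump _ _).intervalIntegrable _ _
        · exact (continuous_comp_line continuous_gridBump _ _).intervalIntegrable _ _
      · exact (continuous_finsetSum _ fun j _ =>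
          continuous_comp_line continuous_gridBump _ _).intervalIntegrable _ _)
  refine ⟨j, ?_⟩
  refine LineBounded.of_net continuous_gridDensity (by positivity)
    (fun x y => by
      have := abs_gridDensity_sub_le (D := D * M ^ d) (ℓ := ℓ * (b * M)) (b := b')
        (k := fun q => childCorner b M (k q.1) q.2 (j q)) x y
      exact this) F hnet fun y hy => ?_
  rw [intervalIntegral_gridDensity]
  refine (hj ⟨y, hy⟩).trans ?_
  gcongr
  have h1 : (F.card : ℝ) ≤ (2 * G + 1) ^ (2 * d) := by
    have : Fintype.card (Fin d ⊕ Fin d) = 2 * d := by simp; ring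
    rw [this] at hFcard
    exact_mod_cast hFcard
  have h2 : (0 : ℝ) < F.card := by exact_mod_cast hFe.card_pos
  calc Real.log (Fintype.card F) ≤ Real.log ((2 * G + 1) ^ (2 * d)) := by
        rw [Fintype.card_coe]; exact Real.log_le_log h2 h1
    _ = _ := by rw [Real.log_pow]; push_cast; ring

end

/-! ### Scales, weights and the number of cubes. -/

/-- Side ratio between blocks and the subcubes they keep, in the `n`-th refinement. -/
def subdiv (n : ℕ) : ℕ := 2 ^ (n + 1)

/-- Number of blocks along each edge of a cube, in the `n`-th refinement. -/
def blocks (d n : ℕ) : ℕ := 4 * subdiv n ^ (d - 1)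

/-- Inverse side length of the cubes of the `n`-th generation. -/
def invSide (d : ℕ) : ℕ → ℕ
  | 0 => 1
  | n + 1 => invSide d n * (blocks d n * subdiv n)

/-- Normalising factor of the density of the `n`-th generation. -/
def dens (d : ℕ) : ℕ → ℕ
  | 0 => 1
  | n + 1 => dens d n * subdiv n ^ d

/-- Index type of the cubes of the `n`-th generation. -/
def Idx (d : ℕ) : ℕ → Type
  | 0 => Unit
  | n + 1 => Idx d n × (Fin d → Fin (blocks d n - 2))

instance Idx.fintype (d : ℕ) : ∀ n, Fintype (Idx d n)
  | 0 => inferInstanceAs (Fintype Unit)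
  | n + 1 =>
    haveI := Idx.fintype d n
    inferInstanceAs (Fintype (Idx d n × (Fin d → Fin (blocks d n - 2))))

section
variable {d : ℕ}

lemma subdiv_pos (n : ℕ) : 0 < subdiv n := by unfold subdiv; positivity

lemma four_le_blocks (d n : ℕ) : 4 ≤ blocks d n :=
  Nat.le_mul_of_pos_right _ (pow_pos (subdiv_pos n) _)

lemma blocks_mul_subdiv (hd : 2 ≤ d) (n : ℕ) : blocks d n * subdiv n = 4 * subdiv n ^ d := by
  rw [blocks, mul_assoc, ← pow_succ, Nat.sub_add_cancel (by omega)]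

/-- The ratio `dens / invSide = 4 ^ (-n)` bounds the contribution of one cube to a line integral.
The factor `4` in `blocks` produces this decay, at the cost of a factor `4 ^ n` in the number of
cubes. -/
lemma invSide_eq (hd : 2 ≤ d) (n : ℕ) : invSide d n = 4 ^ n * dens d n := by
  induction n with
  | zero => rfl
  | succ n ih => rw [invSide, dens, ih, blocks_mul_subdiv hd]; ring

lemma invSide_succ (hd : 2 ≤ d) (n : ℕ) :
    invSide d (n + 1) = invSide d n * 2 ^ (2 + (n + 1) * d) := by
  rw [invSide, blocks_mul_subdiv hd, subdiv, ← pow_mul, pow_add]; rfl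

lemma invSide_pos (d n : ℕ) : 0 < invSide d n := by
  induction n with
  | zero => exact one_pos
  | succ n ih =>
    exact Nat.mul_pos ih (Nat.mul_pos (by have := four_le_blocks d n; omega) (subdiv_pos n))

lemma invSide_mono (hd : 2 ≤ d) : Monotone (invSide d) :=
  monotone_nat_of_le_succ fun n => by
    rw [invSide_succ hd]; exact Nat.le_mul_of_pos_right _ (by positivity)

/-- Together with `invSide_le`, this says that `log (invSide d n)` has order `n ^ 2`. Factors such
as `4 ^ n` are thus negligible for dimensions, while logarithms of net sizes remain polynomial in
`n`. -/
lemma two_pow_le_invSide (hd : 2 ≤ d) (n : ℕ) : 2 ^ n ^ 2 ≤ invSide d n := by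
  induction n with
  | zero => exact le_rfl
  | succ n ih =>
    rw [invSide_succ hd]
    calc 2 ^ (n + 1) ^ 2 = 2 ^ n ^ 2 * 2 ^ (2 * n + 1) := by rw [← pow_add]; ring_nf
      _ ≤ _ := Nat.mul_le_mul ih (Nat.pow_le_pow_right (by norm_num) (by nlinarith))

lemma invSide_le (hd : 2 ≤ d) (n : ℕ) : invSide d n ≤ 2 ^ ((d + 2) * (n + 1) ^ 2) := by
  induction n with
  | zero => exact Nat.one_le_two_pow
  | succ n ih =>
    rw [invSide_succ hd]
    calc _ ≤ 2 ^ ((d + 2) * (n + 1) ^ 2) * 2 ^ (2 + (n + 1) * d) := Nat.mul_le_mul_right _ ih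
      _ = 2 ^ ((d + 2) * (n + 1) ^ 2 + (2 + (n + 1) * d)) := (pow_add _ _ _).symm
      _ ≤ _ := Nat.pow_le_pow_right (by norm_num) (by nlinarith)

lemma four_pow_le_invSide (hd : 2 ≤ d) (n : ℕ) : 4 ^ n ≤ invSide d n := by
  have h0 : 0 < dens d n := by
    have h := invSide_pos d n
    rw [invSide_eq hd] at h
    exact Nat.pos_of_mul_pos_left h
  rw [invSide_eq hd]
  exact Nat.le_mul_of_pos_right _ h0

lemma dens_le_invSide (hd : 2 ≤ d) (n : ℕ) : dens d n ≤ invSide d n := by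
  rw [invSide_eq hd]; exact Nat.le_mul_of_pos_left _ (by positivity)

lemma blocks_le_invSide (d n : ℕ) : blocks d n ≤ invSide d (n + 1) := by
  rw [invSide]
  calc blocks d n = 1 * (blocks d n * 1) := by ring
    _ ≤ _ := Nat.mul_le_mul (invSide_pos d n) (Nat.mul_le_mul_left _ (subdiv_pos n))

lemma card_idx_zero (d : ℕ) : Fintype.card (Idx d 0) = 1 := rfl

lemma card_idx_succ (d n : ℕ) :
    Fintype.card (Idx d (n + 1)) = Fintype.card (Idx d n) * (blocks d n - 2) ^ d := by
  change Fintype.card (Idx d n × (Fin d → Fin (blocks d n - 2))) = _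
  simp

/-- Since `b = 4 * M ^ (d - 1)`, one has `b ^ d = 4 * (b * M) ^ (d - 1)`, so each step costs only an
extra factor `4`. -/
lemma card_idx_le (hd : 2 ≤ d) (n : ℕ) :
    Fintype.card (Idx d n) ≤ 4 ^ n * invSide d n ^ (d - 1) := by
  induction n with
  | zero => simp [card_idx_zero, invSide]
  | succ n ih =>
    have h : blocks d n ^ d = 4 * (blocks d n * subdiv n) ^ (d - 1) := by
      obtain ⟨e, rfl⟩ : ∃ e, d = e + 1 := ⟨d - 1, by omega⟩
      simp only [blocks, Nat.add_sub_cancel]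
      ring
    rw [card_idx_succ, invSide, mul_pow]
    calc _ ≤ 4 ^ n * invSide d n ^ (d - 1) * blocks d n ^ d :=
          Nat.mul_le_mul ih (Nat.pow_le_pow_left (Nat.sub_le _ _) _)
      _ = _ := by rw [h]; ring

lemma card_idx_le_invSide_pow (hd : 2 ≤ d) (n : ℕ) :
    Fintype.card (Idx d n) ≤ invSide d n ^ d := by
  refine (card_idx_le hd n).trans ?_
  calc _ ≤ invSide d n * invSide d n ^ (d - 1) :=
        Nat.mul_le_mul_right _ (four_pow_le_invSide hd n)
    _ = _ := by rw [← pow_succ', Nat.sub_add_cancel (by omega)]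

/-- Dropping boundary blocks costs a factor `1 - 2 / b` per edge. As `b ≥ 2 ^ (n + 3)`, the product
of these factors stays above `1 / 2`; the decreasing term `(1 / 2) ^ (n + 1)` makes the induction
close. -/
lemma le_card_idx_mul_dens (hd : 2 ≤ d) (n : ℕ) :
    ((1 / 2 + (1 / 2) ^ (n + 1)) * invSide d n : ℝ) ^ d ≤ Fintype.card (Idx d n) * dens d n := by
  induction n with
  | zero => simp [card_idx_zero, invSide, dens]; norm_num
  | succ n ih =>
    have hb : ((blocks d n - 2 : ℕ) : ℝ) = blocks d n - 2 := by
      rw [Nat.cast_sub (by have := four_le_blocks d n; omega)]; norm_num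
    have hb8 : (2 : ℝ) ^ (n + 3) ≤ blocks d n := by
      have : 2 ^ (n + 3) ≤ blocks d n := by
        rw [blocks, subdiv, ← pow_mul, show 4 = 2 ^ 2 from rfl, ← pow_add]
        refine Nat.pow_le_pow_right (by norm_num) ?_
        have : (n + 1) * 1 ≤ (n + 1) * (d - 1) := Nat.mul_le_mul_left _ (by omega)
        omega
      exact_mod_cast this
    have hx : (2 : ℝ) ≤ (1 / 2) ^ (n + 2) * blocks d n := by
      calc (2 : ℝ) = (1 / 2) ^ (n + 2) * 2 ^ (n + 3) := by
            rw [pow_succ 2 (n + 2), ← mul_assoc, ← mul_pow]; norm_num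
        _ ≤ _ := by gcongr
    have hx4 : ((1 : ℝ) / 2) ^ (n + 2) ≤ 1 / 4 := by
      calc ((1 : ℝ) / 2) ^ (n + 2) = (1 / 2) ^ n * (1 / 4) := by ring
        _ ≤ 1 * (1 / 4) := by gcongr; exact pow_le_one₀ (by norm_num) (by norm_num)
        _ = _ := one_mul _
    have hx2 : ((1 : ℝ) / 2) ^ (n + 1) = 2 * (1 / 2) ^ (n + 2) := by ring
    have hs : (0 : ℝ) ≤ subdiv n := Nat.cast_nonneg _
    have hl : (0 : ℝ) ≤ invSide d n := Nat.cast_nonneg _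
    calc ((1 / 2 + (1 / 2) ^ (n + 2)) * invSide d (n + 1) : ℝ) ^ d
        = ((1 / 2 + (1 / 2) ^ (n + 2)) * blocks d n * (invSide d n * subdiv n) : ℝ) ^ d := by
          rw [invSide]; push_cast; ring
      _ ≤ ((1 / 2 + (1 / 2) ^ (n + 1)) * (blocks d n - 2) * (invSide d n * subdiv n) : ℝ) ^ d := by
          refine pow_le_pow_left₀ (by positivity)
            (mul_le_mul_of_nonneg_right ?_ (by positivity)) d
          rw [hx2]
          nlinarith
      _ = ((1 / 2 + (1 / 2) ^ (n + 1)) * invSide d n : ℝ) ^ d *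
          ((blocks d n - 2) * subdiv n) ^ d := by rw [← mul_pow]; ring
      _ ≤ (Fintype.card (Idx d n) * dens d n) * ((blocks d n - 2) * subdiv n) ^ d := by
          have : (4 : ℝ) ≤ blocks d n := by exact_mod_cast four_le_blocks d n
          exact mul_le_mul_of_nonneg_right ih (pow_nonneg (mul_nonneg (by linarith) hs) d)
      _ = _ := by
          rw [card_idx_succ, dens]
          push_cast
          rw [hb, mul_pow]
          ring

lemma lineBounded_zero : LineBounded
    (gridDensity (dens d 0) (invSide d 0) (blocks d 0) (fun (_ : Idx d 0) (_ : Fin d) => 0)) 1 := by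
  intro p _ v hv
  rw [intervalIntegral_gridDensity]
  have h := intervalIntegral_gridBump_le (b := blocks d 0) (k := fun _ => 0) (ℓ := 1) one_pos p hv
  have : (Finset.univ : Finset (Idx d 0)).card = 1 := card_idx_zero d
  simpa [dens, invSide, this] using h

lemma LineBounded.mono {g : (Fin d → ℝ) → ℝ} {U V : ℝ} (h : LineBounded g U) (hUV : U ≤ V) :
    LineBounded g V :=
  fun p hp v hv => (h p hp v hv).trans hUV

/-! ### Iteration with summable errors. -/

/-- The error of the `n`-th refinement. -/
noncomputable def refineError (d n : ℕ) : ℝ :=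
  (1 / 2) ^ (n + 1) * (1 + 2 * d * (((d + 3) * (d + 2) + 1 : ℕ) * (n + 3) ^ 2))

lemma summable_refineError (d : ℕ) : Summable (refineError d) := by
  have h1 : Summable fun n : ℕ => ((n + 3 : ℕ) : ℝ) ^ 2 * (1 / 2 : ℝ) ^ (n + 3) :=
    (summable_nat_add_iff 3).mpr
      (summable_pow_mul_geometric_of_norm_lt_one 2 (r := (1 / 2 : ℝ)) (by norm_num))
  have h2 : Summable fun n : ℕ => (1 / 2 : ℝ) ^ (n + 1) :=
    (summable_nat_add_iff 1).mpr (summable_geometric_of_lt_one (by norm_num) (by norm_num))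
  refine (h2.add (h1.mul_left (4 * (2 * (d : ℝ) * ((d + 3) * (d + 2) + 1 : ℕ))))).congr fun n => ?_
  simp only [refineError]
  push_cast
  ring

lemma refineError_nonneg (d n : ℕ) : 0 ≤ refineError d n := by
  unfold refineError; positivity

lemma LineBounded.exists_succ (hd : 2 ≤ d) (n : ℕ) (k : Idx d n → Fin d → ℕ) {U : ℝ} (hU0 : 0 ≤ U)
    (hU : LineBounded (gridDensity (dens d n) (invSide d n) (blocks d n) k) U) :
    ∃ k' : Idx d (n + 1) → Fin d → ℕ,
      (∀ q, ∃ j, k' q = childCorner (blocks d n) (subdiv n) (k q.1) q.2 j) ∧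
      LineBounded (gridDensity (dens d (n + 1)) (invSide d (n + 1)) (blocks d (n + 1)) k')
        ((1 + refineError d n) * U + refineError d n) := by
  -- The power of `invSide` dominates the Lipschitz constant of the new density, so the net error is
  -- at most `(1 / 2) ^ (n + 1)`, and `log G` is still quadratic in `n`.
  set G : ℕ := invSide d (n + 2) ^ (d + 3) * 2 ^ (n + 3) with hGdef
  have hl2 := invSide_pos d (n + 2)
  have hG : 0 < G := by positivity
  have hη : ((dens d (n + 1) : ℕ) : ℝ) / (invSide d (n + 1) : ℕ) = (1 / 4) ^ (n + 1) := by
    have hl := invSide_pos d (n + 1)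
    have h := invSide_eq hd (n + 1)
    have hD : (dens d (n + 1) : ℝ) ≠ 0 := by
      intro h0
      rw [h, Nat.cast_eq_zero.mp h0] at hl
      simp at hl
    rw [h]
    push_cast
    field_simp
    rw [← mul_pow]; norm_num
  have hθη : (2 : ℝ) ^ (n + 1) * (((dens d (n + 1) : ℕ) : ℝ) / (invSide d (n + 1) : ℕ)) =
      (1 / 2) ^ (n + 1) := by
    rw [hη, ← mul_pow]; norm_num
  obtain ⟨j, hj⟩ := hU.exists_children (invSide_pos d n)
    (by have := four_le_blocks d n; omega) (subdiv_pos n) (blocks d (n + 1)) hG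
    -- This `θ` lies between `1` and `1 / η = 4 ^ (n + 1)`: both the relative error `θ * η` and the
    -- additive error `log (2 * G + 1) / θ` become summable.
    (θ := 2 ^ (n + 1)) (by positivity) (by
      change (2 : ℝ) ^ (n + 1) * (((dens d (n + 1) : ℕ) : ℝ) / (invSide d (n + 1) : ℕ)) ≤ 1
      rw [hθη]
      exact pow_le_one₀ (by norm_num) (by norm_num))
  refine ⟨fun q => childCorner (blocks d n) (subdiv n) (k q.1) q.2 (j q), fun q => ⟨j q, rfl⟩, ?_⟩
  refine LineBounded.mono hj ?_
  change (1 + (2 : ℝ) ^ (n + 1) * (((dens d (n + 1) : ℕ) : ℝ) / (invSide d (n + 1) : ℕ))) * U +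
    2 * d * Real.log (2 * G + 1) / 2 ^ (n + 1) + ((dens d (n + 1) : ℕ) *
      Fintype.card (Idx d (n + 1)) * ((invSide d (n + 1) : ℕ) * (blocks d (n + 1)))) * (4 / G) ≤ _
  rw [hθη]
  have hlog : Real.log (2 * G + 1) ≤ ((d + 3) * (d + 2) + 1 : ℕ) * (n + 3) ^ 2 := by
    have h1 : 2 * G + 1 ≤ 2 ^ (((d + 3) * (d + 2) + 1) * (n + 3) ^ 2) := by
      calc 2 * G + 1 ≤ 4 * G := by omega
        _ ≤ 2 ^ 2 * ((2 ^ ((d + 2) * (n + 3) ^ 2)) ^ (d + 3) * 2 ^ (n + 3)) := by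
            rw [hGdef]
            gcongr
            · norm_num
            · exact invSide_le hd (n + 2)
        _ = 2 ^ ((d + 2) * (n + 3) ^ 2 * (d + 3) + (n + 5)) := by
            rw [← pow_mul, ← pow_add, ← pow_add]; ring_nf
        _ ≤ _ := Nat.pow_le_pow_right (by norm_num) (by nlinarith)
    calc Real.log (2 * G + 1) ≤ Real.log (2 ^ (((d + 3) * (d + 2) + 1) * (n + 3) ^ 2)) := by
          refine Real.log_le_log (by positivity) ?_
          exact_mod_cast h1
      _ = (((d + 3) * (d + 2) + 1) * (n + 3) ^ 2 : ℕ) * Real.log 2 := by rw [Real.log_pow]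
      _ ≤ (((d + 3) * (d + 2) + 1) * (n + 3) ^ 2 : ℕ) * 1 := by
          gcongr
          linarith [Real.log_two_lt_d9]
      _ = _ := by push_cast; ring
  have hK : ((dens d (n + 1) : ℕ) * Fintype.card (Idx d (n + 1)) *
      ((invSide d (n + 1) : ℕ) * (blocks d (n + 1))) : ℝ) * (4 / G) ≤ (1 / 2) ^ (n + 1) := by
    have h1 : dens d (n + 1) * Fintype.card (Idx d (n + 1)) *
        (invSide d (n + 1) * blocks d (n + 1)) ≤ invSide d (n + 2) ^ (d + 3) := by
      have hm := invSide_mono hd (Nat.le_succ (n + 1))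
      calc _ ≤ invSide d (n + 2) * invSide d (n + 2) ^ d *
            (invSide d (n + 2) * invSide d (n + 2)) := by
            refine Nat.mul_le_mul (Nat.mul_le_mul ((dens_le_invSide hd _).trans hm) ?_)
              (Nat.mul_le_mul hm (blocks_le_invSide d (n + 1)))
            exact (card_idx_le_invSide_pow hd _).trans (Nat.pow_le_pow_left hm _)
        _ = _ := by ring
    have h1' : ((dens d (n + 1) : ℕ) * Fintype.card (Idx d (n + 1)) *
      ((invSide d (n + 1) : ℕ) * (blocks d (n + 1))) : ℝ) ≤ (invSide d (n + 2) : ℝ) ^ (d + 3) := by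
      exact_mod_cast h1
    have hlp : (0 : ℝ) < (invSide d (n + 2) : ℝ) ^ (d + 3) := by positivity
    calc _ ≤ (invSide d (n + 2) : ℝ) ^ (d + 3) * (4 / G) := by gcongr
      _ = (1 / 2) ^ (n + 1) := by
        rw [hGdef]; push_cast
        rw [show (2 : ℝ) ^ (n + 3) = 4 * 2 ^ (n + 1) by ring, one_div, inv_pow]
        field_simp
  have hlog' : 2 * d * Real.log (2 * G + 1) / 2 ^ (n + 1) ≤
      (1 / 2) ^ (n + 1) * (2 * d * (((d + 3) * (d + 2) + 1 : ℕ) * (n + 3) ^ 2)) := by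
    rw [div_eq_mul_inv, mul_comm, ← inv_pow, ← one_div]
    gcongr
  have hε : (1 / 2 : ℝ) ^ (n + 1) ≤ refineError d n := by
    unfold refineError
    refine le_mul_of_one_le_right (by positivity) ?_
    have : (0 : ℝ) ≤ 2 * d * (((d + 3) * (d + 2) + 1 : ℕ) * (n + 3) ^ 2) := by positivity
    linarith
  have hsum : (1 / 2 : ℝ) ^ (n + 1) * (2 * d * (((d + 3) * (d + 2) + 1 : ℕ) * (n + 3) ^ 2)) +
      (1 / 2) ^ (n + 1) = refineError d n := by unfold refineError; ring
  have hmulU := mul_le_mul_of_nonneg_right hε hU0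
  linarith

/-- The nested families of cubes, with line integrals of the densities bounded uniformly. -/
theorem exists_cubes (hd : 2 ≤ d) : ∃ (k : ∀ n, Idx d n → Fin d → ℕ) (B : ℝ),
    (∀ q, k 0 q = fun _ => 0) ∧
    (∀ n q, ∃ j, k (n + 1) q = childCorner (blocks d n) (subdiv n) (k n q.1) q.2 j) ∧
    ∀ n, LineBounded (gridDensity (dens d n) (invSide d n) (blocks d n) (k n)) B := by
  -- Under `U ↦ (1 + ε) * U + ε` the quantity `U + 1` is multiplied by `1 + ε ≤ exp ε`; the initial
  -- value is `U 0 = 1`.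
  let U : ℕ → ℝ := fun n => 2 * Real.exp (∑ i ∈ Finset.range n, refineError d i) - 1
  have hsum0 : ∀ n, 0 ≤ ∑ i ∈ Finset.range n, refineError d i := fun n =>
    Finset.sum_nonneg fun i _ => refineError_nonneg d i
  have hU0 : ∀ n, 0 ≤ U n := fun n => by
    have := Real.one_le_exp (hsum0 n)
    simp only [U]; linarith
  have hUsucc : ∀ n, (1 + refineError d n) * U n + refineError d n ≤ U (n + 1) := by
    intro n
    simp only [U]
    rw [Finset.sum_range_succ, Real.exp_add]
    have h1 := Real.add_one_le_exp (refineError d n)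
    have h2 := Real.exp_pos (∑ i ∈ Finset.range n, refineError d i)
    nlinarith
  let P : ℕ → Type := fun n => {k : Idx d n → Fin d → ℕ //
    LineBounded (gridDensity (dens d n) (invSide d n) (blocks d n) k) (U n)}
  have step : ∀ n (k : P n), ∃ k' : P (n + 1),
      ∀ q, ∃ j, k'.1 q = childCorner (blocks d n) (subdiv n) (k.1 q.1) q.2 j := by
    intro n k
    obtain ⟨k', h1, h2⟩ := LineBounded.exists_succ hd n k.1 (hU0 n) k.2
    exact ⟨⟨k', h2.mono (hUsucc n)⟩, h1⟩
  choose next hnext using step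
  let k₀ : P 0 := ⟨fun _ _ => 0, by
    have : U 0 = 1 := by simp [U]; norm_num
    rw [this]; exact lineBounded_zero⟩
  let K : ∀ n, P n := fun n => Nat.rec k₀ (fun n k => next n k) n
  refine ⟨fun n => (K n).1, 2 * Real.exp (∑' i, refineError d i), fun q => rfl,
    fun n q => hnext n (K n) q, fun n => (K n).2.mono ?_⟩
  have h : ∑ i ∈ Finset.range n, refineError d i ≤ ∑' i, refineError d i :=
    (summable_refineError d).sum_le_tsum _ fun i _ => refineError_nonneg d i
  have := Real.exp_le_exp.mpr h
  simp only [U]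
  linarith

end

/-! ### Nested generations and the mass of tubes. -/

/-- The closed grid cube of side `1 / ℓ` with integer corner `k`. -/
def gridCube {d : ℕ} (ℓ : ℕ) (k : Fin d → ℕ) : Set (Fin d → ℝ) :=
  Set.Icc (fun i => (k i : ℝ) / ℓ) (fun i => ((k i : ℝ) + 1) / ℓ)

section
variable {d : ℕ}

lemma mem_gridCube {ℓ : ℕ} (hℓ : 0 < ℓ) {k : Fin d → ℕ} {x : Fin d → ℝ} :
    x ∈ gridCube ℓ k ↔ ∀ i, (k i : ℝ) ≤ ℓ * x i ∧ ℓ * x i ≤ k i + 1 := by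
  have hℓ' : (0 : ℝ) < ℓ := by exact_mod_cast hℓ
  simp only [gridCube, Set.mem_Icc, Pi.le_def, div_le_iff₀ hℓ', le_div_iff₀ hℓ', ← forall_and]
  simp only [mul_comm]

lemma gridCube_childCorner_subset {ℓ b M : ℕ} (hℓ : 0 < ℓ) (hb : 0 < b) (hM : 0 < M)
    (k : Fin d → ℕ) (β : Fin d → Fin (b - 2)) (j : Fin d → Fin M) :
    gridCube (ℓ * (b * M)) (childCorner b M k β j) ⊆ gridCube ℓ k := by
  intro x hx
  have hb' : (0 : ℝ) < b := by exact_mod_cast hb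
  have hM' : (0 : ℝ) < M := by exact_mod_cast hM
  rw [mem_gridCube (by positivity)] at hx
  rw [mem_gridCube hℓ]
  intro i
  obtain ⟨h1, h2⟩ := hx i
  simp only [childCorner] at h1 h2
  push_cast at h1 h2
  have hj : ((j i : ℕ) : ℝ) + 1 ≤ M := by exact_mod_cast (j i).2
  have hβ : ((β i : ℕ) : ℝ) + 3 ≤ b := by
    have := (β i).2
    exact_mod_cast (by omega : (β i : ℕ) + 3 ≤ b)
  have hj0 : (0 : ℝ) ≤ (j i : ℕ) := Nat.cast_nonneg _
  have hβ0 : (0 : ℝ) ≤ (β i : ℕ) := Nat.cast_nonneg _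
  have hbM : (0 : ℝ) < b * M := by positivity
  constructor
  · refine le_of_mul_le_mul_right ?_ hbM
    nlinarith [mul_nonneg hβ0 hM'.le]
  · refine le_of_mul_le_mul_right ?_ hbM
    nlinarith

/-- The union of the cubes of the `n`-th generation. -/
def generation (k : ∀ n, Idx d n → Fin d → ℕ) (n : ℕ) : Set (Fin d → ℝ) :=
  ⋃ q, gridCube (invSide d n) (k n q)

/-- The family of cubes `k (n + 1)` arises from `k n` by keeping one subcube of every interior
block of every cube. -/
def IsRefining (k : ∀ n, Idx d n → Fin d → ℕ) : Prop :=
  (∀ q, k 0 q = fun _ => 0) ∧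
    ∀ n q, ∃ j, k (n + 1) q = childCorner (blocks d n) (subdiv n) (k n q.1) q.2 j

variable {k : ∀ n, Idx d n → Fin d → ℕ}

lemma isCompact_generation (n : ℕ) : IsCompact (generation k n) :=
  isCompact_iUnion fun _ => isCompact_Icc

lemma IsRefining.antitone (hk : IsRefining k) : Antitone (generation k) := by
  refine antitone_nat_of_succ_le fun n x hx => ?_
  obtain ⟨q, hq⟩ := Set.mem_iUnion.mp hx
  obtain ⟨j, hj⟩ := hk.2 n q
  rw [hj] at hq
  exact Set.mem_iUnion.mpr ⟨q.1, gridCube_childCorner_subset (invSide_pos d n)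
    (by have := four_le_blocks d n; omega) (subdiv_pos n) _ _ _ hq⟩

lemma IsRefining.generation_zero_subset (hk : IsRefining k) {x : Fin d → ℝ}
    (hx : x ∈ generation k 0) (i : Fin d) : x i ∈ Set.Icc (0 : ℝ) 1 := by
  obtain ⟨q, hq⟩ := Set.mem_iUnion.mp hx
  rw [hk.1, mem_gridCube (invSide_pos d 0)] at hq
  simpa [invSide] using hq i

lemma mem_generation_of_gridDensity_ne_zero {n b D : ℕ} {x : Fin d → ℝ}
    (hx : gridDensity D (invSide d n) b (k n) x ≠ 0) : x ∈ generation k n := by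
  obtain ⟨q, -, hq⟩ := Finset.exists_ne_zero_of_sum_ne_zero (right_ne_zero_of_mul hx)
  refine Set.mem_iUnion.mpr ⟨q, (mem_gridCube (invSide_pos d n)).mpr fun i => ?_⟩
  have := mul_mem_of_gridBump_ne_zero (invSide_pos d n) hq i
  exact ⟨this.1.le, this.2.le⟩

lemma le_lintegral_gridBump {ℓ b : ℕ} (hℓ : 0 < ℓ) (hb : 4 ≤ b) (k : Fin d → ℕ) :
    ENNReal.ofReal ((1 / (2 * ℓ)) ^ d) ≤ ∫⁻ x, ENNReal.ofReal (gridBump ℓ b k x) := by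
  have hℓ' : (0 : ℝ) < ℓ := by exact_mod_cast hℓ
  have hb' : 1 / (b : ℝ) ≤ 1 / 4 :=
    one_div_le_one_div_of_le (by norm_num) (by exact_mod_cast hb)
  set S : Set (Fin d → ℝ) :=
    Set.Icc (fun i => ((k i : ℝ) + 1 / 4) / ℓ) (fun i => ((k i : ℝ) + 3 / 4) / ℓ)
  calc ENNReal.ofReal ((1 / (2 * ℓ)) ^ d) = volume S := by
        rw [Real.volume_Icc_pi, ← ENNReal.ofReal_prod_of_nonneg]
        · congr 1
          rw [Finset.prod_congr rfl (fun i _ => show ((k i : ℝ) + 3 / 4) / ℓ - (k i + 1 / 4) / ℓ =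
            1 / (2 * ℓ) by field_simp; ring)]
          simp
        · intro i _
          rw [← sub_div]
          exact div_nonneg (by linarith) hℓ'.le
    _ = ∫⁻ x, S.indicator 1 x := (lintegral_indicator_one measurableSet_Icc).symm
    _ ≤ _ := by
        refine lintegral_mono fun x => Set.indicator_apply_le' (fun hx => ?_) fun _ => zero_le
        rw [gridBump_eq_one hℓ (by omega)]
        · simp
        · intro i
          have h1 := hx.1 i
          have h2 := hx.2 i
          simp only [div_le_iff₀ hℓ', le_div_iff₀ hℓ'] at h1 h2
          constructor <;> linarith

lemma le_lintegral_gridDensity (hd : 2 ≤ d) (n : ℕ) (k : Idx d n → Fin d → ℕ) :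
    ENNReal.ofReal ((1 / 4) ^ d) ≤
      ∫⁻ x, ENNReal.ofReal (gridDensity (dens d n) (invSide d n) (blocks d n) k x) := by
  have hℓ' : (0 : ℝ) < invSide d n := by exact_mod_cast invSide_pos d n
  have h1 : ((1 : ℝ) / 4) ^ d ≤
      dens d n * (Fintype.card (Idx d n) * (1 / (2 * invSide d n)) ^ d) := by
    calc ((1 : ℝ) / 4) ^ d = (1 / 2 * invSide d n) ^ d * (1 / (2 * invSide d n)) ^ d := by
          rw [← mul_pow]; congr 1; field_simp; norm_num
      _ ≤ ((1 / 2 + (1 / 2) ^ (n + 1)) * invSide d n) ^ d * (1 / (2 * invSide d n)) ^ d := by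
          gcongr
          exact le_add_of_nonneg_right (by positivity)
      _ ≤ (Fintype.card (Idx d n) * dens d n) * (1 / (2 * invSide d n)) ^ d := by
          gcongr
          exact le_card_idx_mul_dens hd n
      _ = _ := by ring
  refine (ENNReal.ofReal_le_ofReal h1).trans ?_
  have h2 : ∀ x, ENNReal.ofReal (gridDensity (dens d n) (invSide d n) (blocks d n) k x) =
      (dens d n : ℝ≥0∞) * ∑ q, ENNReal.ofReal (gridBump (invSide d n) (blocks d n) (k q) x) := by
    intro x
    rw [gridDensity, ENNReal.ofReal_mul (Nat.cast_nonneg _), ENNReal.ofReal_natCast,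
      ENNReal.ofReal_sum_of_nonneg fun _ _ => gridBump_nonneg]
  simp_rw [h2]
  have hm : ∀ q, Measurable fun x => ENNReal.ofReal
      (gridBump (invSide d n) (blocks d n) (k q) x) :=
    fun q => continuous_gridBump.measurable.ennreal_ofReal
  rw [lintegral_const_mul _ (Finset.measurable_sum _ fun q _ => hm q),
    lintegral_finsetSum _ fun q _ => hm q, ENNReal.ofReal_mul (Nat.cast_nonneg _),
    ENNReal.ofReal_natCast, ENNReal.ofReal_mul (Nat.cast_nonneg _), ENNReal.ofReal_natCast]
  gcongr
  rw [← nsmul_eq_mul]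
  exact Finset.card_nsmul_le_sum _ _ _ fun q _ =>
    le_lintegral_gridBump (invSide_pos d n) (four_le_blocks d n) _

/-- Recentring the line at a point of the support reduces to `t ∈ [-1, 1]`, because the unit cube
has sup-norm diameter `1`. -/
lemma LineBounded.lintegral_line_le {g : (Fin d → ℝ) → ℝ} {B : ℝ} (h : LineBounded g B)
    (hg : Continuous g) (hg0 : ∀ x, 0 ≤ g x) (hsupp : ∀ x, g x ≠ 0 → ∀ i, x i ∈ Set.Icc (0 : ℝ) 1)
    (p : Fin d → ℝ) {v : Fin d → ℝ} (hv : ‖v‖ = 1) :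
    ∫⁻ t : ℝ, ENNReal.ofReal (g (p + t • v)) ≤ ENNReal.ofReal B := by
  by_cases h0 : ∀ t : ℝ, g (p + t • v) = 0
  · simp [h0]
  push Not at h0
  obtain ⟨t₀, ht₀⟩ := h0
  set p₀ := p + t₀ • v
  have hp₀ := hsupp _ ht₀
  have hcont := continuous_comp_line hg p₀ v
  rw [← lintegral_add_right_eq_self _ t₀]
  have heq : ∀ t : ℝ, ENNReal.ofReal (g (p + (t + t₀) • v)) =
      (Set.Icc (-1 : ℝ) 1).indicator (fun t => ENNReal.ofReal (g (p₀ + t • v))) t := by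
    intro t
    have hx : p + (t + t₀) • v = p₀ + t • v := by simp only [p₀]; module
    rw [hx]
    by_cases hz : g (p₀ + t • v) = 0
    · rw [hz]; simp [Set.indicator, hz]
    rw [Set.indicator_of_mem]
    rw [Set.mem_Icc, ← abs_le]
    calc |t| = ‖t • v‖ := by rw [norm_smul, hv, mul_one, Real.norm_eq_abs]
      _ ≤ 1 := by
        rw [pi_norm_le_iff_of_nonneg zero_le_one]
        intro i
        have h1 := hsupp _ hz i
        have h2 := hp₀ i
        simp only [Pi.add_apply, Set.mem_Icc] at h1 h2
        rw [Real.norm_eq_abs, abs_le]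
        constructor <;> linarith [h1.1, h1.2, h2.1, h2.2]
  simp_rw [heq]
  rw [lintegral_indicator measurableSet_Icc, ← ofReal_integral_eq_lintegral_ofReal
    hcont.integrableOn_Icc (ae_of_all _ fun t => hg0 _)]
  refine ENNReal.ofReal_le_ofReal ?_
  rw [integral_Icc_eq_integral_Ioc, ← intervalIntegral.integral_of_le (by norm_num)]
  exact h p₀ hp₀ v hv

/-- Fubini over the translates of the axis by vectors `u` of norm at most `2 * w`: a point of the
tube is reached for a set of `t` of length at least `w`, each translate carries at most `B`, and the
ball of translations has volume `(4 * w) ^ d`. Dividing by `w` leaves `w ^ (d - 1)`. -/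
lemma LineBounded.setLIntegral_tube_le {g : (Fin d → ℝ) → ℝ} {B : ℝ} (h : LineBounded g B)
    (hd : 0 < d) (hg : Continuous g) (hg0 : ∀ x, 0 ≤ g x)
    (hsupp : ∀ x, g x ≠ 0 → ∀ i, x i ∈ Set.Icc (0 : ℝ) 1)
    (p : Fin d → ℝ) {v : Fin d → ℝ} (hv : ‖v‖ = 1) {w : ℝ} (hw : 0 < w) {T : Set (Fin d → ℝ)}
    (hT : MeasurableSet T) (hTw : ∀ x ∈ T, ∃ t : ℝ, ‖x - (p + t • v)‖ ≤ w) :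
    ∫⁻ x in T, ENNReal.ofReal (g x) ≤ ENNReal.ofReal (4 ^ d * B) * ENNReal.ofReal (w ^ (d - 1)) := by
  set F : (Fin d → ℝ) → ℝ≥0∞ := fun x => ENNReal.ofReal (g x) with hF
  have hFm : Measurable F := hg.measurable.ennreal_ofReal
  set χ : (Fin d → ℝ) → ℝ≥0∞ := (Metric.closedBall (0 : Fin d → ℝ) (2 * w)).indicator 1 with hχ
  have hχm : Measurable χ := measurable_one.indicator Metric.isClosed_closedBall.measurableSet
  have hlow : ∀ x ∈ T, ENNReal.ofReal w ≤ ∫⁻ t : ℝ, χ (x - (p + t • v)) := by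
    intro x hx
    obtain ⟨t₀, ht₀⟩ := hTw x hx
    calc ENNReal.ofReal w ≤ volume (Set.Icc (t₀ - w) (t₀ + w)) := by
          rw [Real.volume_Icc]; exact ENNReal.ofReal_le_ofReal (by linarith)
      _ = ∫⁻ t, (Set.Icc (t₀ - w) (t₀ + w)).indicator 1 t :=
          (lintegral_indicator_one measurableSet_Icc).symm
      _ ≤ _ := by
          refine lintegral_mono fun t => Set.indicator_apply_le' (fun ht => ?_) fun _ => zero_le
          have : x - (p + t • v) ∈ Metric.closedBall (0 : Fin d → ℝ) (2 * w) := by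
            rw [mem_closedBall_zero_iff]
            calc ‖x - (p + t • v)‖ = ‖(x - (p + t₀ • v)) + (t₀ - t) • v‖ := by congr 1; module
              _ ≤ w + w := by
                refine (norm_add_le _ _).trans (add_le_add ht₀ ?_)
                rw [norm_smul, hv, mul_one, Real.norm_eq_abs, abs_le]
                constructor <;> linarith [ht.1, ht.2]
              _ = 2 * w := by ring
          simp only [hχ]
          rw [Set.indicator_of_mem this]
          exact le_rfl
  have hmeas : Measurable fun z : (Fin d → ℝ) × ℝ => F z.1 * χ (z.1 - (p + z.2 • v)) :=
    (hFm.comp measurable_fst).mul (hχm.comp (by fun_prop))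
  have hmeas' : Measurable fun z : ℝ × (Fin d → ℝ) => F (z.2 + (p + z.1 • v)) * χ z.2 :=
    (hFm.comp (by fun_prop)).mul (hχm.comp measurable_snd)
  have key : ENNReal.ofReal w * ∫⁻ x in T, F x ≤ ENNReal.ofReal B * ENNReal.ofReal ((4 * w) ^ d) := by
    calc ENNReal.ofReal w * ∫⁻ x in T, F x = ∫⁻ x in T, F x * ENNReal.ofReal w := by
          rw [lintegral_mul_const _ hFm, mul_comm]
      _ ≤ ∫⁻ x in T, F x * ∫⁻ t : ℝ, χ (x - (p + t • v)) :=
          setLIntegral_mono' hT fun x hx => by gcongr; exact hlow x hx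
      _ ≤ ∫⁻ x, F x * ∫⁻ t : ℝ, χ (x - (p + t • v)) := setLIntegral_le_lintegral _ _
      _ = ∫⁻ x, ∫⁻ t : ℝ, F x * χ (x - (p + t • v)) := by
          congr 1; ext x
          rw [lintegral_const_mul]
          exact hχm.comp (by fun_prop)
      _ = ∫⁻ t : ℝ, ∫⁻ x, F x * χ (x - (p + t • v)) :=
          lintegral_lintegral_swap hmeas.aemeasurable
      _ = ∫⁻ t : ℝ, ∫⁻ u, F (u + (p + t • v)) * χ u := by
          congr 1; ext t
          rw [← lintegral_add_right_eq_self _ (p + t • v)]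
          simp
      _ = ∫⁻ u, ∫⁻ t : ℝ, F (u + (p + t • v)) * χ u :=
          lintegral_lintegral_swap hmeas'.aemeasurable
      _ ≤ ∫⁻ u, ENNReal.ofReal B * χ u := by
          refine lintegral_mono fun u => ?_
          rw [lintegral_mul_const]
          · gcongr
            simp_rw [← add_assoc]
            exact h.lintegral_line_le hg hg0 hsupp (u + p) hv
          · exact hFm.comp (by fun_prop)
      _ = _ := by
          rw [lintegral_const_mul _ hχm, hχ,
            lintegral_indicator_one Metric.isClosed_closedBall.measurableSet,
            Real.volume_pi_closedBall _ (by positivity), Fintype.card_fin]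
          ring_nf
  rw [← ENNReal.mul_le_mul_iff_right (a := ENNReal.ofReal w) (by simpa using hw) (by simp)]
  refine key.trans (le_of_eq ?_)
  by_cases hB : 0 ≤ B
  · rw [← ENNReal.ofReal_mul hB, ← ENNReal.ofReal_mul (by positivity),
      ← ENNReal.ofReal_mul hw.le]
    congr 1
    rw [mul_pow]
    conv_lhs => rw [← Nat.sub_add_cancel (by omega : 1 ≤ d), pow_succ w, Nat.sub_add_cancel hd]
    ring
  · push Not at hB
    rw [ENNReal.ofReal_of_nonpos hB.le, ENNReal.ofReal_of_nonpos (mul_nonpos_of_nonneg_of_nonpos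
      (by positivity) hB.le)]
    simp

/-- A lower bound for the widths of tubes that cover the limit set. -/
theorem IsRefining.exists_le_tsum (hd : 2 ≤ d) (hk : IsRefining k) {B : ℝ}
    (hB : ∀ n, LineBounded (gridDensity (dens d n) (invSide d n) (blocks d n) (k n)) B) :
    ∃ c : ℝ, 0 < c ∧ ∀ (ι : Type) [Countable ι] (T : ι → Set (Fin d → ℝ)) (w : ι → ℝ),
      (∀ i, IsOpen (T i) ∧ 0 < w i ∧ ∃ p v : Fin d → ℝ, ‖v‖ = 1 ∧
        ∀ x ∈ T i, ∃ t : ℝ, ‖x - (p + t • v)‖ ≤ w i) →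
      (⋂ n, generation k n) ⊆ ⋃ i, T i →
      ENNReal.ofReal c ≤ ∑' i, ENNReal.ofReal (w i ^ (d - 1)) := by
  set B' := max B 1
  have hB'0 : 0 < B' := zero_lt_one.trans_le (le_max_right _ _)
  refine ⟨(1 / 4) ^ d / (4 ^ d * B'), by positivity, ?_⟩
  intro ι _ T w hT hcov
  -- By compactness the open tubes already cover a whole generation, so its density can be
  -- integrated and no limit measure is needed.
  obtain ⟨n, hn⟩ := exists_subset_nhds_of_isCompact (V := generation k)
    (fun i j => ⟨max i j, hk.antitone (le_max_left _ _), hk.antitone (le_max_right _ _)⟩)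
    (fun n => isCompact_generation n)
    (fun x hx => (isOpen_iUnion fun i => (hT i).1).mem_nhds (hcov hx))
  set g := gridDensity (dens d n) (invSide d n) (blocks d n) (k n)
  have hsub : ∀ x, g x ≠ 0 → x ∈ generation k n := fun x hx =>
    mem_generation_of_gridDensity_ne_zero hx
  have h1 : ENNReal.ofReal ((1 / 4) ^ d) ≤
      ENNReal.ofReal (4 ^ d * B') * ∑' i, ENNReal.ofReal (w i ^ (d - 1)) := by
    calc ENNReal.ofReal ((1 / 4) ^ d) ≤ ∫⁻ x, ENNReal.ofReal (g x) :=
          le_lintegral_gridDensity hd n (k n)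
      _ = ∫⁻ x in ⋃ i, T i, ENNReal.ofReal (g x) := by
          rw [← lintegral_indicator (isOpen_iUnion fun i => (hT i).1).measurableSet]
          congr 1; ext x
          by_cases hx : g x = 0
          · simp [Set.indicator, hx]
          · rw [Set.indicator_of_mem (hn (hsub x hx))]
      _ ≤ ∑' i, ∫⁻ x in T i, ENNReal.ofReal (g x) := lintegral_iUnion_le _ _
      _ ≤ ∑' i, ENNReal.ofReal (4 ^ d * B') * ENNReal.ofReal (w i ^ (d - 1)) := by
          refine ENNReal.tsum_le_tsum fun i => ?_
          obtain ⟨ho, hw, p, v, hv, hx⟩ := hT i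
          exact ((hB n).mono (le_max_left _ _)).setLIntegral_tube_le (by omega)
            continuous_gridDensity gridDensity_nonneg
            (fun x hx => hk.generation_zero_subset (hk.antitone (Nat.zero_le n) (hsub x hx)))
            p hv hw ho.measurableSet hx
      _ = _ := ENNReal.tsum_mul_left
  rw [ENNReal.ofReal_div_of_pos (by positivity)]
  exact ENNReal.div_le_of_le_mul' h1

end

/-! ### Transfer to Euclidean space; lower bounds from the failure of tube nullity. -/

section
variable {d : ℕ}

/-- The compact subset of Euclidean space in which the nested generations of cubes intersect. -/
def limitSet (k : ∀ n, Idx d n → Fin d → ℕ) : Set (EuclideanSpace ℝ (Fin d)) :=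
  {x | x.ofLp ∈ ⋂ n, generation k n}

/-- Passage to the sup norm: it is at most the Euclidean norm, so the width survives, and only the
direction vector has to be rescaled. -/
lemma IsTube.exists_line {w : ℝ} {T : Set (EuclideanSpace ℝ (Fin d))} (hT : IsTube w T) :
    ∃ p v : Fin d → ℝ, ‖v‖ = 1 ∧ ∀ x ∈ T, ∃ t : ℝ, ‖x.ofLp - (p + t • v)‖ ≤ w := by
  obtain ⟨-, l, hl, rfl⟩ := hT
  have hne : (l : Set (EuclideanSpace ℝ (Fin d))).Nonempty := by
    rw [AffineSubspace.nonempty_iff_ne_bot]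
    rintro rfl
    rw [AffineSubspace.direction_bot, finrank_bot] at hl
    exact zero_ne_one hl
  obtain ⟨p, hp⟩ := hne
  obtain ⟨v, hv0, hv⟩ := finrank_eq_one_iff'.mp hl
  have hv0' : v.1.ofLp ≠ 0 := by
    intro h
    apply hv0
    ext i
    simp [h]
  have hvn : ‖v.1.ofLp‖ ≠ 0 := norm_ne_zero_iff.mpr hv0'
  refine ⟨p.ofLp, ‖v.1.ofLp‖⁻¹ • v.1.ofLp, ?_, fun x hx => ?_⟩
  · rw [norm_smul, norm_inv, norm_norm, inv_mul_cancel₀ hvn]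
  obtain ⟨z, hz, hxz⟩ := Metric.mem_thickening_iff.mp hx
  obtain ⟨s, hs⟩ := hv ⟨z -ᵥ p, AffineSubspace.vsub_mem_direction hz hp⟩
  have hs' : s • v.1 = z - p := congrArg Subtype.val hs
  refine ⟨s * ‖v.1.ofLp‖, ?_⟩
  have hz' : p.ofLp + (s * ‖v.1.ofLp‖) • (‖v.1.ofLp‖⁻¹ • v.1.ofLp) = z.ofLp := by
    rw [smul_smul, mul_assoc, mul_inv_cancel₀ hvn, mul_one, ← WithLp.ofLp_smul, hs',
      WithLp.ofLp_sub]
    abel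
  rw [hz', ← dist_eq_norm]
  have h := (PiLp.lipschitzWith_ofLp 2 fun _ : Fin d => ℝ).dist_le_mul x z
  rw [NNReal.coe_one, one_mul] at h
  exact h.trans hxz.le

lemma IsTube.isOpen {w : ℝ} {T : Set (EuclideanSpace ℝ (Fin d))} (hT : IsTube w T) : IsOpen T := by
  obtain ⟨-, l, -, rfl⟩ := hT
  exact Metric.isOpen_thickening

theorem IsRefining.not_isTubeNull_limitSet (hd : 2 ≤ d) {k : ∀ n, Idx d n → Fin d → ℕ}
    (hk : IsRefining k) {B : ℝ}
    (hB : ∀ n, LineBounded (gridDensity (dens d n) (invSide d n) (blocks d n) (k n)) B) :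
    ¬ IsTubeNull (limitSet k) := by
  intro hnull
  obtain ⟨c, hc, h⟩ := hk.exists_le_tsum hd hB
  obtain ⟨ι, _, T, w, hT, hcov, hsum⟩ := hnull (c / 2) (by positivity)
  have h1 := h ι (fun i => WithLp.toLp 2 ⁻¹' T i) w (fun i => by
      obtain ⟨p, v, hv, hx⟩ := (hT i).exists_line
      exact ⟨(hT i).isOpen.preimage (PiLp.continuous_toLp 2 _), (hT i).1, p, v, hv,
        fun x hxT => hx _ hxT⟩) (by
      intro x hx
      have : WithLp.toLp 2 x ∈ limitSet k := hx
      simpa using hcov this)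
  have h2 := h1.trans hsum
  rw [ENNReal.ofReal_le_ofReal_iff (by positivity)] at h2
  linarith

lemma exists_isTube (hd : 0 < d) (y : EuclideanSpace ℝ (Fin d)) {w : ℝ} (hw : 0 < w) :
    ∃ T, IsTube w T ∧ Metric.ball y w ⊆ T := by
  have he : EuclideanSpace.single (⟨0, hd⟩ : Fin d) (1 : ℝ) ≠ 0 := by simp
  refine ⟨_, ⟨hw, AffineSubspace.mk' y (Submodule.span ℝ {EuclideanSpace.single ⟨0, hd⟩ 1}), ?_,
    rfl⟩, fun x hx => Metric.mem_thickening_iff.mpr ⟨y, AffineSubspace.self_mem_mk' _ _, hx⟩⟩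
  rw [AffineSubspace.direction_mk', finrank_span_singleton he]

lemma isTubeNull_empty : IsTubeNull (∅ : Set (EuclideanSpace ℝ (Fin d))) :=
  fun _ _ => ⟨Empty, inferInstance, Empty.elim, Empty.elim, by simp, by simp, by simp⟩

lemma nonempty_of_not_isTubeNull {A : Set (EuclideanSpace ℝ (Fin d))} (hA : ¬ IsTubeNull A) :
    A.Nonempty := by
  rw [Set.nonempty_iff_ne_empty]
  rintro rfl
  exact hA isTubeNull_empty

lemma exists_le_coveringNumber_of_not_isTubeNull (hd : 0 < d)
    {A : Set (EuclideanSpace ℝ (Fin d))} (hA : ¬ IsTubeNull A) :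
    ∃ δ : ℝ, 0 < δ ∧ ∀ r : ℝ≥0, 0 < r → Metric.externalCoveringNumber r A ≠ ⊤ →
      δ ≤ (Metric.externalCoveringNumber r A).toNat * (2 * r : ℝ) ^ (d - 1) := by
  unfold IsTubeNull at hA
  push Not at hA
  obtain ⟨δ, hδ, h⟩ := hA
  refine ⟨δ, hδ, fun r hr hfin => ?_⟩
  have hr' : (0 : ℝ) < r := hr
  have hlt : Metric.externalCoveringNumber r A < Metric.externalCoveringNumber r A + 1 := by
    rw [ENat.lt_add_one_iff hfin]
  conv_lhs at hlt => rw [Metric.externalCoveringNumber]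
  simp only [iInf_lt_iff] at hlt
  obtain ⟨C, hC, hCcard⟩ := hlt
  rw [ENat.lt_add_one_iff hfin] at hCcard
  have hCfin : C.Finite := Set.encard_lt_top_iff.mp (hCcard.trans_lt hfin.lt_top)
  -- Width `2 * r` rather than `r`, because the covering balls are closed and tubes are open.
  choose T hT hTy using fun y : C => exists_isTube hd y.1 (w := 2 * r) (by positivity)
  have : Finite C := hCfin
  have h1 := h C inferInstance T (fun _ => 2 * r) hT (by
    intro x hx
    obtain ⟨y, hy, hxy⟩ := Set.mem_iUnion₂.mp (Metric.isCover_iff_subset_iUnion_closedBall.mp hC hx)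
    refine Set.mem_iUnion.mpr ⟨⟨y, hy⟩, hTy _ ?_⟩
    rw [Metric.mem_closedBall] at hxy
    rw [Metric.mem_ball]
    linarith)
  have hN : (Set.encard C).toNat ≤ (Metric.externalCoveringNumber r A).toNat :=
    ENat.toNat_le_toNat hCcard hfin
  rw [ENNReal.tsum_const] at h1
  have hcard : ENat.card C = ((Set.encard C).toNat : ℕ) := by
    rw [ENat.natCast_toNat hCfin.encard_lt_top.ne]; rfl
  rw [hcard, ENat.toENNReal_coe, ← ENNReal.ofReal_natCast,
    ← ENNReal.ofReal_mul (Nat.cast_nonneg _), ENNReal.ofReal_lt_ofReal_iff_of_nonneg hδ.le] at h1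
  refine h1.le.trans ?_
  gcongr

/-- If the dimension were smaller, the `(d - 1)`-dimensional Hausdorff measure would vanish, and
efficient covers would enlarge to tubes of small total weight. -/
lemma le_dimH_of_not_isTubeNull (hd : 2 ≤ d) {A : Set (EuclideanSpace ℝ (Fin d))}
    (hA : ¬ IsTubeNull A) : ((d - 1 : ℕ) : ℝ≥0∞) ≤ dimH A := by
  by_contra! hlt
  have h0 : μH[((d - 1 : ℕ) : ℝ≥0)] A = 0 := hausdorffMeasure_of_dimH_lt (by exact_mod_cast hlt)
  refine hA fun δ hδ => ?_
  set m := d - 1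
  have hm : 1 ≤ m := by omega
  set ε : ℝ≥0∞ := ENNReal.ofReal (δ / (2 * 2 ^ m)) with hε
  have hε0 : 0 < ε := by rw [hε, ENNReal.ofReal_pos]; positivity
  rw [Measure.hausdorffMeasure_apply] at h0
  have h1 := le_of_le_of_eq (le_iSup₂ (f := fun (r : ℝ≥0∞) (_ : 0 < r) =>
    ⨅ (t : ℕ → Set (EuclideanSpace ℝ (Fin d))) (_ : A ⊆ ⋃ n, t n)
      (_ : ∀ n, Metric.ediam (t n) ≤ r),
      ∑' n, ⨆ _ : (t n).Nonempty, Metric.ediam (t n) ^ (((m : ℕ) : ℝ≥0) : ℝ)) 1 one_pos) h0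
  have h2 := h1.trans_lt hε0
  simp only [iInf_lt_iff] at h2
  obtain ⟨t, hAt, htd, hsum⟩ := h2
  obtain ⟨η, hη0, hη⟩ := ENNReal.exists_pos_sum_of_countable hε0.ne' ℕ
  -- A summable amount added to each diameter, since a tube must have positive width even around a
  -- single point.
  let e : ℕ → ℝ := fun n => min (η n) 1
  have he0 : ∀ n, 0 < e n := fun n => lt_min (hη0 n) one_pos
  have hfin : ∀ n, Metric.ediam (t n) ≠ ⊤ := fun n => ((htd n).trans_lt ENNReal.one_lt_top).ne
  have htube : ∀ n, ∃ (T : Set (EuclideanSpace ℝ (Fin d))) (w : ℝ), IsTube w T ∧ t n ⊆ T ∧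
      ENNReal.ofReal (w ^ m) ≤ ENNReal.ofReal (2 ^ m) *
        ((⨆ _ : (t n).Nonempty, Metric.ediam (t n) ^ (((m : ℕ) : ℝ≥0) : ℝ)) + η n) := by
    intro n
    have heη : ENNReal.ofReal (e n ^ m) ≤ η n := by
      rw [← ENNReal.ofReal_coe_nnreal]
      refine ENNReal.ofReal_le_ofReal ?_
      calc e n ^ m ≤ e n ^ 1 := pow_le_pow_of_le_one (he0 n).le (min_le_right _ _) hm
        _ ≤ η n := by rw [pow_one]; exact min_le_left _ _
    have h2m : (1 : ℝ) ≤ 2 ^ m := one_le_pow₀ (by norm_num)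
    rcases (t n).eq_empty_or_nonempty with hte | htn
    · obtain ⟨T, hT, -⟩ := exists_isTube (by omega) (0 : EuclideanSpace ℝ (Fin d)) (he0 n)
      refine ⟨T, e n, hT, by simp [hte], ?_⟩
      rw [← one_mul (ENNReal.ofReal (e n ^ m))]
      gcongr
      · exact ENNReal.one_le_ofReal.mpr h2m
      · exact heη.trans le_add_self
    · obtain ⟨y, hy⟩ := htn
      have hD : 0 ≤ Metric.diam (t n) := Metric.diam_nonneg
      obtain ⟨T, hT, hTy⟩ := exists_isTube (by omega) y (add_pos_of_nonneg_of_pos hD (he0 n))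
      refine ⟨T, _, hT, fun x hx => hTy ?_, ?_⟩
      · rw [Metric.mem_ball]
        have := Metric.dist_le_diam_of_mem' (hfin n) hx hy
        linarith [he0 n]
      · rw [iSup_pos ⟨y, hy⟩]
        have h3 : Metric.ediam (t n) = ENNReal.ofReal (Metric.diam (t n)) :=
          (ENNReal.ofReal_toReal (hfin n)).symm
        have h4 : Metric.ediam (t n) ^ (((m : ℕ) : ℝ≥0) : ℝ) =
            ENNReal.ofReal (Metric.diam (t n) ^ m) := by
          rw [NNReal.coe_natCast, ENNReal.rpow_natCast, h3, ENNReal.ofReal_pow hD]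
        rw [h4]
        refine le_trans ?_ (mul_le_mul_right (add_le_add_right heη _) _)
        rw [← ENNReal.ofReal_add (by positivity) (pow_nonneg (he0 n).le _),
          ← ENNReal.ofReal_mul (by positivity)]
        refine ENNReal.ofReal_le_ofReal ((add_pow_le hD (he0 n).le m).trans ?_)
        have : 0 ≤ Metric.diam (t n) ^ m + e n ^ m :=
          add_nonneg (by positivity) (pow_nonneg (he0 n).le _)
        gcongr
        · norm_num
        · omega
  choose T w hT htT hw using htube
  refine ⟨ℕ, inferInstance, T, w, hT, hAt.trans (Set.iUnion_mono htT), ?_⟩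
  calc ∑' n, ENNReal.ofReal (w n ^ m) ≤ ∑' n, ENNReal.ofReal (2 ^ m) *
        ((⨆ _ : (t n).Nonempty, Metric.ediam (t n) ^ (((m : ℕ) : ℝ≥0) : ℝ)) + η n) :=
        ENNReal.tsum_le_tsum hw
    _ ≤ ENNReal.ofReal (2 ^ m) * (ε + ε) := by
        rw [ENNReal.tsum_mul_left, ENNReal.tsum_add]
        gcongr
    _ = ENNReal.ofReal δ := by
        rw [hε, ← ENNReal.ofReal_add (by positivity) (by positivity),
          ← ENNReal.ofReal_mul (by positivity)]
        congr 1
        field_simp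
        norm_num

end

/-! ### Pure unrectifiability. -/

section
variable {d : ℕ} {k : ∀ n, Idx d n → Fin d → ℕ}

lemma EuclideanSpace.dist_le_card_mul {x y : EuclideanSpace ℝ (Fin d)} {a : ℝ} (ha : 0 ≤ a)
    (h : ∀ i, |x i - y i| ≤ a) : dist x y ≤ d * a := by
  rcases Nat.eq_zero_or_pos d with rfl | hd
  · simp [Subsingleton.elim x y]
  have hd' : (1 : ℝ) ≤ d := by exact_mod_cast hd
  rw [EuclideanSpace.dist_eq]
  refine Real.sqrt_le_iff.mpr ⟨by positivity, ?_⟩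
  calc ∑ i, dist (x i) (y i) ^ 2 ≤ ∑ _i : Fin d, a ^ 2 := by
        refine Finset.sum_le_sum fun i _ => pow_le_pow_left₀ dist_nonneg ?_ 2
        rw [Real.dist_eq]; exact h i
    _ = d * a ^ 2 := by simp
    _ ≤ d * (d * a ^ 2) := by
        gcongr
        exact le_mul_of_one_le_left (by positivity) hd'
    _ = (d * a) ^ 2 := by ring

lemma dist_le_of_mem_gridCube {ℓ : ℕ} (hℓ : 0 < ℓ) {c : Fin d → ℕ}
    {x y : EuclideanSpace ℝ (Fin d)} (hx : x.ofLp ∈ gridCube ℓ c) (hy : y.ofLp ∈ gridCube ℓ c) :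
    dist x y ≤ d / ℓ := by
  have hℓ' : (0 : ℝ) < ℓ := by exact_mod_cast hℓ
  rw [mem_gridCube hℓ] at hx hy
  rw [div_eq_mul_one_div]
  refine EuclideanSpace.dist_le_card_mul (by positivity) fun i => ?_
  rw [le_div_iff₀ hℓ', ← abs_of_pos hℓ', ← abs_mul, abs_le]
  constructor <;> linarith [(hx i).1, (hx i).2, (hy i).1, (hy i).2]

lemma limitSet_subset_iUnion (n : ℕ) :
    limitSet k ⊆ ⋃ q, WithLp.ofLp ⁻¹' gridCube (invSide d n) (k n q) := by
  intro x hx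
  have := Set.mem_iInter.mp hx n
  simpa [generation] using this

/-- Dividing a corner by `subdiv n` gives its block, and dividing that by `blocks d n` gives the
corner of the parent. Hence a block holds only one cube of the next generation. -/
lemma IsRefining.eq_of_div_eq (hk : IsRefining k) (n : ℕ) {q q' : Idx d (n + 1)}
    (h : ∀ i, k (n + 1) q i / subdiv n = k (n + 1) q' i / subdiv n) : q = q' := by
  induction n with
  | zero =>
    obtain ⟨j, hj⟩ := hk.2 0 q
    obtain ⟨j', hj'⟩ := hk.2 0 q'
    simp only [hj, hj', childCorner_div (subdiv_pos 0), hk.1] at h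
    refine Prod.ext (Subsingleton.elim (α := Unit) _ _) (funext fun i => Fin.ext ?_)
    have := h i
    omega
  | succ n ih =>
    obtain ⟨j, hj⟩ := hk.2 (n + 1) q
    obtain ⟨j', hj'⟩ := hk.2 (n + 1) q'
    simp only [hj, hj', childCorner_div (subdiv_pos (n + 1))] at h
    have hb : 2 ≤ blocks d (n + 1) := by have := four_le_blocks d (n + 1); omega
    have h1 : ∀ i, k (n + 1) q.1 i = k (n + 1) q'.1 i := by
      intro i
      have := congrArg (· / blocks d (n + 1)) (h i)
      simpa only [block_div hb] using this
    refine Prod.ext (ih fun i => by rw [h1 i]) (funext fun i => Fin.ext ?_)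
    have := h i
    rw [h1 i] at this
    omega

/-- The limit set meets a Lipschitz arc over a unit interval in a set of zero length: a piece of
the arc of diameter at most the side of a block meets at most `4 ^ d` blocks, each of which contains
just one, much smaller, cube of the next generation. -/
lemma IsRefining.hausdorffMeasure_inter_image_eq_zero (hk : IsRefining k) {K : ℝ≥0}
    {γ : ℝ → EuclideanSpace ℝ (Fin d)} (hγ : LipschitzWith K γ) (m : ℤ) :
    μH[1] (limitSet k ∩ γ '' Set.Icc (m : ℝ) (m + 1)) = 0 := by
  obtain ⟨N, hN⟩ := exists_nat_gt (K : ℝ)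
  have hN0 : 0 < N := by
    have : (0 : ℝ) < N := K.coe_nonneg.trans_lt hN
    exact_mod_cast this
  let σ : ℕ → ℕ := fun n => invSide d n * blocks d n
  have hσ : ∀ n, 0 < σ n := fun n =>
    Nat.mul_pos (invSide_pos d n) (by have := four_le_blocks d n; omega)
  let P : ℕ → ℕ := fun n => N * σ n
  have hP : ∀ n, 0 < P n := fun n => Nat.mul_pos hN0 (hσ n)
  -- The arc is sampled at `P n` times, between which it moves by at most the block side `1 / σ n`.
  -- A block met near a sample has coordinates from `u - 2` to `u + 1`, hence the offsets in `Fin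
  -- 4`.
  let u : ∀ n, Fin (P n) → Fin d → ℤ := fun n i l =>
    ⌊(σ n : ℝ) * γ (m + ((i : ℕ) : ℝ) / P n) l⌋
  let t : ∀ n, Fin (P n) × (Fin d → Fin 4) → Set (EuclideanSpace ℝ (Fin d)) := fun n z =>
    {x | ∃ q : Idx d (n + 1), x.ofLp ∈ gridCube (invSide d (n + 1)) (k (n + 1) q) ∧
      ∀ l, ((k (n + 1) q l / subdiv n : ℕ) : ℤ) = u n z.1 l - 2 + ((z.2 l : ℕ) : ℤ)}
  have hdiam : ∀ n z, Metric.ediam (t n z) ≤ ENNReal.ofReal (d / invSide d (n + 1)) := by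
    intro n z
    refine Metric.ediam_le ?_
    rintro x ⟨q, hx, hq⟩ y ⟨q', hy, hq'⟩
    obtain rfl : q = q' := hk.eq_of_div_eq n fun i => by
      have := (hq i).trans (hq' i).symm
      exact_mod_cast this
    rw [edist_dist]
    exact ENNReal.ofReal_le_ofReal (dist_le_of_mem_gridCube (invSide_pos d _) hx hy)
  have hcover : ∀ n, limitSet k ∩ γ '' Set.Icc (m : ℝ) (m + 1) ⊆ ⋃ z, t n z := by
    rintro n x ⟨hxA, s, hs, rfl⟩
    obtain ⟨q, hq⟩ := Set.mem_iUnion.mp (limitSet_subset_iUnion (n + 1) hxA)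
    have hP' : (0 : ℝ) < P n := by exact_mod_cast hP n
    obtain ⟨i, hi⟩ : ∃ i : Fin (P n), |s - (m + ((i : ℕ) : ℝ) / P n)| ≤ 1 / P n := by
      rcases hs.2.eq_or_lt with hs1 | hs1
      · refine ⟨⟨P n - 1, by have := hP n; omega⟩, le_of_eq ?_⟩
        rw [hs1, Nat.cast_sub (hP n)]
        have : (m : ℝ) + 1 - (m + ((P n : ℝ) - (1 : ℕ)) / P n) = 1 / P n := by
          push_cast; field_simp; ring
        rw [this, abs_of_pos (by positivity)]
      · have h0 : 0 ≤ (s - m) * P n := mul_nonneg (by linarith [hs.1]) hP'.le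
        refine ⟨⟨⌊(s - m) * P n⌋₊, (Nat.floor_lt h0).mpr (by nlinarith)⟩, ?_⟩
        have h1 := Nat.floor_le h0
        have h2 := Nat.lt_floor_add_one ((s - m) * P n)
        have h3 : s - (m + ((⌊(s - m) * P n⌋₊ : ℕ) : ℝ) / P n) =
            ((s - m) * P n - (⌊(s - m) * P n⌋₊ : ℕ)) / P n := by field_simp; ring
        simp only
        rw [h3, abs_of_nonneg (div_nonneg (by linarith) hP'.le)]
        gcongr
        linarith
    have hσ' : (0 : ℝ) < σ n := by exact_mod_cast hσ n
    have hclose : ∀ l, |(σ n : ℝ) * γ s l - σ n * γ (m + ((i : ℕ) : ℝ) / P n) l| ≤ 1 := by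
      intro l
      set s' := m + ((i : ℕ) : ℝ) / P n
      have h1 : |γ s l - γ s' l| ≤ K * (1 / P n) := by
        calc |γ s l - γ s' l| ≤ dist (γ s) (γ s') := by
              rw [dist_eq_norm, ← Real.norm_eq_abs]
              exact PiLp.norm_apply_le (γ s - γ s') l
          _ ≤ K * dist s s' := hγ.dist_le_mul _ _
          _ ≤ _ := by rw [Real.dist_eq]; gcongr
      rw [← mul_sub, abs_mul, Nat.abs_cast]
      calc (σ n : ℝ) * |γ s l - γ s' l| ≤ σ n * (N * (1 / P n)) := by gcongr; exact h1.trans (by gcongr)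
        _ = 1 := by simp only [P]; push_cast; field_simp
    have hblock : ∀ l, ((k (n + 1) q l / subdiv n : ℕ) : ℝ) ≤ σ n * γ s l ∧
        σ n * γ s l ≤ (k (n + 1) q l / subdiv n : ℕ) + 1 := by
      intro l
      obtain ⟨h1, h2⟩ := (mem_gridCube (invSide_pos d (n + 1))).mp hq l
      have hM : (0 : ℝ) < subdiv n := by exact_mod_cast subdiv_pos n
      have hl : (invSide d (n + 1) : ℝ) * γ s l = (σ n * γ s l) * subdiv n := by
        simp only [σ, invSide]; push_cast; ring
      rw [hl] at h1 h2
      have h3 : ((k (n + 1) q l / subdiv n : ℕ) : ℝ) * subdiv n ≤ k (n + 1) q l := by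
        exact_mod_cast Nat.div_mul_le_self _ _
      have h4 : (k (n + 1) q l : ℝ) + 1 ≤ ((k (n + 1) q l / subdiv n : ℕ) + 1) * subdiv n := by
        have := Nat.lt_div_mul_add (a := k (n + 1) q l) (subdiv_pos n)
        have h5 : k (n + 1) q l + 1 ≤ (k (n + 1) q l / subdiv n + 1) * subdiv n := by
          rw [add_mul, one_mul]; exact this
        exact_mod_cast h5
      exact ⟨le_of_mul_le_mul_right (h3.trans h1) hM, le_of_mul_le_mul_right (h2.trans h4) hM⟩
    have hrange : ∀ l, 0 ≤ ((k (n + 1) q l / subdiv n : ℕ) : ℤ) - (u n i l - 2) ∧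
        ((k (n + 1) q l / subdiv n : ℕ) : ℤ) - (u n i l - 2) < 4 := by
      intro l
      have h1 := abs_le.mp (hclose l)
      have h2 := hblock l
      have h3 := Int.floor_le ((σ n : ℝ) * γ (m + ((i : ℕ) : ℝ) / P n) l)
      have h4 := Int.lt_floor_add_one ((σ n : ℝ) * γ (m + ((i : ℕ) : ℝ) / P n) l)
      have h5 : ((u n i l : ℤ) : ℝ) ≤ ((k (n + 1) q l / subdiv n : ℕ) : ℤ) + 2 := by
        rw [Int.cast_natCast]; simp only [u]; linarith
      have h6 : (((k (n + 1) q l / subdiv n : ℕ) : ℤ) : ℝ) < (u n i l : ℤ) + 2 := by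
        rw [Int.cast_natCast]; simp only [u]; linarith
      have h5' : u n i l ≤ ((k (n + 1) q l / subdiv n : ℕ) : ℤ) + 2 := by exact_mod_cast h5
      have h6' : ((k (n + 1) q l / subdiv n : ℕ) : ℤ) < u n i l + 2 := by exact_mod_cast h6
      constructor <;> omega
    refine Set.mem_iUnion.mpr ⟨(i, fun l =>
      ⟨(((k (n + 1) q l / subdiv n : ℕ) : ℤ) - (u n i l - 2)).toNat, ?_⟩), q, hq, fun l => ?_⟩
    · have := hrange l
      omega
    · have := hrange l
      simp only
      omega
  have hlim : Tendsto (fun n : ℕ => ENNReal.ofReal (N * 4 ^ d * d * (1 / 2) ^ (n + 1)))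
      atTop (𝓝 0) := by
    rw [← ENNReal.ofReal_zero]
    refine ENNReal.tendsto_ofReal ?_
    rw [← mul_zero ((N : ℝ) * 4 ^ d * d)]
    exact ((tendsto_add_atTop_iff_nat 1).mpr
      (tendsto_pow_atTop_nhds_zero_of_lt_one (by norm_num) (by norm_num))).const_mul _
  -- The number of blocks met grows like `σ n`, whereas cube diameters are of order `1 / (σ n * 2 ^
  -- (n + 1))`, so the total length tends to `0`.
  have hside : ∀ n, (P n : ℝ) * 4 ^ d * (d / invSide d (n + 1)) =
      N * 4 ^ d * d * (1 / 2) ^ (n + 1) := by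
    intro n
    have hσ' : (0 : ℝ) < σ n := by exact_mod_cast hσ n
    have : (invSide d (n + 1) : ℝ) = σ n * 2 ^ (n + 1) := by
      simp only [σ, invSide, subdiv]; push_cast; ring
    rw [this, one_div, inv_pow]
    simp only [P]
    push_cast
    field_simp
  have hone : ∀ n, 1 ≤ P n * 4 ^ d := fun n => Nat.mul_pos (hP n) (by positivity)
  have hr : Tendsto (fun n => ENNReal.ofReal (d / invSide d (n + 1))) atTop (𝓝 0) := by
    refine tendsto_of_tendsto_of_tendsto_of_le_of_le tendsto_const_nhds hlim
      (fun _ => zero_le) fun n => ENNReal.ofReal_le_ofReal ?_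
    rw [← hside]
    refine le_mul_of_one_le_left (by positivity) ?_
    exact_mod_cast hone n
  have h := Measure.hausdorffMeasure_le_liminf_sum 1 _ _ hr t (.of_forall hdiam)
    (.of_forall hcover)
  refine le_antisymm (h.trans ?_) zero_le
  rw [← hlim.liminf_eq]
  refine liminf_le_liminf (.of_forall fun n => ?_)
  calc ∑ z, Metric.ediam (t n z) ^ (1 : ℝ)
      ≤ ∑ _z : Fin (P n) × (Fin d → Fin 4), ENNReal.ofReal (d / invSide d (n + 1)) := by
        refine Finset.sum_le_sum fun z _ => ?_
        rw [ENNReal.rpow_one]; exact hdiam n z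
    _ = ENNReal.ofReal (P n * 4 ^ d * (d / invSide d (n + 1))) := by
        rw [Finset.sum_const, nsmul_eq_mul, ENNReal.ofReal_mul (by positivity)]
        congr 1
        simp only [Finset.card_univ, Fintype.card_prod, Fintype.card_fin, Fintype.card_pi,
          Finset.prod_const]
        rw [← ENNReal.ofReal_natCast]
        push_cast
        rfl
    _ ≤ _ := by rw [hside]

theorem IsRefining.isPurelyUnrectifiable_limitSet (hk : IsRefining k) :
    IsPurelyUnrectifiable (limitSet k) := by
  intro K γ hγ
  have hsub : limitSet k ∩ Set.range γ ⊆
      ⋃ m : ℤ, limitSet k ∩ γ '' Set.Icc (m : ℝ) (m + 1) := by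
    rintro _ ⟨hx, s, rfl⟩
    exact Set.mem_iUnion.mpr ⟨⌊s⌋, hx, s, ⟨Int.floor_le s, (Int.lt_floor_add_one s).le⟩, rfl⟩
  exact measure_mono_null hsub
    (measure_iUnion_null fun m => hk.hausdorffMeasure_inter_image_eq_zero hγ m)

lemma isBounded_limitSet : Bornology.IsBounded (limitSet k) := by
  refine Metric.isBounded_iff.mpr ⟨d / invSide d 0, fun x hx y hy => ?_⟩
  obtain ⟨q, hq⟩ := Set.mem_iUnion.mp (limitSet_subset_iUnion 0 hx)
  obtain ⟨q', hq'⟩ := Set.mem_iUnion.mp (limitSet_subset_iUnion 0 hy)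
  obtain rfl : q = q' := Subsingleton.elim (α := Unit) q q'
  exact dist_le_of_mem_gridCube (invSide_pos d 0) hq hq'

end

/-! ### Upper bounds on the dimensions and the box-counting limit. -/

section
variable {d : ℕ} {k : ∀ n, Idx d n → Fin d → ℕ}

lemma externalCoveringNumber_limitSet_le (n : ℕ) {r : ℝ≥0} (hr : (d : ℝ) / invSide d n ≤ r) :
    Metric.externalCoveringNumber r (limitSet k) ≤ Fintype.card (Idx d n) := by
  classical
  let c : Idx d n → EuclideanSpace ℝ (Fin d) := fun q =>
    WithLp.toLp 2 fun i => (k n q i : ℝ) / invSide d n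
  have hcov : Metric.IsCover r (limitSet k) (Finset.univ.image c : Finset _) := by
    rw [Metric.isCover_iff_subset_iUnion_closedBall]
    intro x hx
    obtain ⟨q, hq⟩ := Set.mem_iUnion.mp (limitSet_subset_iUnion n hx)
    refine Set.mem_iUnion₂.mpr ⟨c q, by simp, ?_⟩
    rw [Metric.mem_closedBall]
    refine (dist_le_of_mem_gridCube (invSide_pos d n) hq ?_).trans hr
    exact ⟨fun i => le_rfl, fun i => by simp only [c]; gcongr; linarith⟩
  refine hcov.externalCoveringNumber_le_encard.trans ?_
  rw [Set.encard_coe_eq_coe_finsetCard]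
  exact_mod_cast Finset.card_image_le

lemma dimH_limitSet_le (hd : 2 ≤ d) : dimH (limitSet k) ≤ ((d - 1 : ℕ) : ℝ≥0∞) := by
  have key : ∀ s : ℝ≥0, ((d - 1 : ℕ) : ℝ≥0) < s → dimH (limitSet k) ≤ s := by
    intro s hs
    have hs' : ((d - 1 : ℕ) : ℝ) < s := by exact_mod_cast hs
    set τ : ℝ := s - (d - 1 : ℕ) with hτ
    have hτ0 : 0 < τ := sub_pos.mpr hs'
    have hr : Tendsto (fun n => ENNReal.ofReal (d / invSide d n)) atTop (𝓝 0) := by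
      rw [← ENNReal.ofReal_zero]
      refine ENNReal.tendsto_ofReal (Tendsto.div_atTop tendsto_const_nhds ?_)
      refine tendsto_atTop_mono (f := fun n : ℕ => (4 : ℝ) ^ n) (fun n => ?_)
        (tendsto_pow_atTop_atTop_of_one_lt (by norm_num))
      exact_mod_cast four_pow_le_invSide hd n
    have hdiam : ∀ n (q : Idx d n), Metric.ediam (WithLp.ofLp ⁻¹'
        gridCube (invSide d n) (k n q) : Set (EuclideanSpace ℝ (Fin d))) ≤
        ENNReal.ofReal (d / invSide d n) := by
      refine fun n q => Metric.ediam_le fun x hx y hy => ?_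
      rw [edist_dist]
      exact ENNReal.ofReal_le_ofReal (dist_le_of_mem_gridCube (invSide_pos d n) hx hy)
    have h := Measure.hausdorffMeasure_le_liminf_sum (s : ℝ) _ _ hr
      (fun n q => (WithLp.ofLp ⁻¹' gridCube (invSide d n) (k n q) :
        Set (EuclideanSpace ℝ (Fin d)))) (.of_forall hdiam)
      (.of_forall limitSet_subset_iUnion)
    refine dimH_le_of_hausdorffMeasure_ne_top (ne_top_of_le_ne_top
      (ENNReal.ofReal_ne_top (r := (d : ℝ) ^ (s : ℝ) * 2 ^ (1 / τ))) (h.trans ?_))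
    refine (liminf_le_liminf (.of_forall fun n => ?_)).trans (liminf_const _).le
    have hℓ : (0 : ℝ) < invSide d n := by exact_mod_cast invSide_pos d n
    calc ∑ q : Idx d n, Metric.ediam (WithLp.ofLp ⁻¹' gridCube (invSide d n) (k n q) :
          Set (EuclideanSpace ℝ (Fin d))) ^ (s : ℝ)
        ≤ ∑ _q : Idx d n, ENNReal.ofReal (d / invSide d n) ^ (s : ℝ) :=
          Finset.sum_le_sum fun q _ => ENNReal.rpow_le_rpow (hdiam n q) s.coe_nonneg
      _ = ENNReal.ofReal (Fintype.card (Idx d n) * (d / invSide d n) ^ (s : ℝ)) := by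
          rw [Finset.sum_const, nsmul_eq_mul, ENNReal.ofReal_mul (Nat.cast_nonneg _),
            ENNReal.ofReal_natCast, ENNReal.ofReal_rpow_of_nonneg (by positivity) s.coe_nonneg]
          rfl
      _ ≤ _ := by
          refine ENNReal.ofReal_le_ofReal ?_
          have hcard : (Fintype.card (Idx d n) : ℝ) ≤ 4 ^ n * (invSide d n : ℝ) ^ (d - 1) := by
            exact_mod_cast card_idx_le hd n
          have h2 : (2 : ℝ) ^ ((n : ℝ) ^ 2) ≤ invSide d n := by
            have : ((2 ^ n ^ 2 : ℕ) : ℝ) ≤ invSide d n := by exact_mod_cast two_pow_le_invSide hd n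
            refine le_trans (le_of_eq ?_) this
            rw [← Nat.cast_pow, Real.rpow_natCast]
            push_cast
            rfl
          calc Fintype.card (Idx d n) * ((d : ℝ) / invSide d n) ^ (s : ℝ)
              ≤ (4 ^ n * (invSide d n : ℝ) ^ (d - 1)) * ((d : ℝ) / invSide d n) ^ (s : ℝ) := by
                gcongr
            _ = (d : ℝ) ^ (s : ℝ) * (4 ^ n * (invSide d n : ℝ) ^ (-τ)) := by
                rw [Real.div_rpow (by positivity) hℓ.le, hτ, neg_sub, Real.rpow_sub hℓ,
                  Real.rpow_natCast]
                ring
            _ ≤ (d : ℝ) ^ (s : ℝ) * (2 ^ (2 * n : ℝ) * (2 ^ ((n : ℝ) ^ 2)) ^ (-τ)) := by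
                refine mul_le_mul_of_nonneg_left (mul_le_mul (le_of_eq ?_)
                  (Real.rpow_le_rpow_of_nonpos (by positivity) h2 (by linarith))
                  (by positivity) (by positivity)) (by positivity)
                rw [Real.rpow_mul (by norm_num), Real.rpow_natCast]
                norm_num
            _ ≤ (d : ℝ) ^ (s : ℝ) * 2 ^ (1 / τ) := by
                rw [← Real.rpow_mul (by norm_num), ← Real.rpow_add (by norm_num)]
                gcongr
                · norm_num
                · rw [le_div_iff₀ hτ0]
                  -- The exponent is `2 * n - τ * n ^ 2`, at most `1 / τ` because `(n * τ - 1) ^ 2 ≥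
                  -- 0`.
                  nlinarith [sq_nonneg (n * τ - 1)]
  refine le_of_forall_gt_imp_ge_of_dense fun a ha => ?_
  obtain ⟨s, hs1, hs2⟩ := ENNReal.lt_iff_exists_nnreal_btwn.mp ha
  exact (key s (by exact_mod_cast hs1)).trans hs2.le

/-- Cover by the first generation `m + 1` with cubes of diameter at most `r`. Passing from `m` to `m
+ 1` changes `log (invSide d ·)` by `O(m)`, and `m` is `O(√(log (1 / r)))`, so the error is of lower
order. -/
lemma log_coveringNumber_limitSet_le (hd : 2 ≤ d) {r : ℝ≥0} (hr : 0 < r) (hrd : (r : ℝ) < d) :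
    Real.log ((Metric.externalCoveringNumber r (limitSet k)).toNat : ℝ) ≤
      (d - 1 : ℕ) * Real.log (1 / r) + ((2 + (d - 1 : ℕ) * (Real.log d + 2 + d)) +
        (2 + (d - 1 : ℕ) * d) * √(2 * (Real.log d + Real.log (1 / r)))) := by
  have hr' : (0 : ℝ) < r := hr
  have hd' : (0 : ℝ) < d := by positivity
  have hex : ∃ n, (d : ℝ) / invSide d n ≤ r := by
    obtain ⟨n, hn⟩ := pow_unbounded_of_one_lt ((d : ℝ) / r) (by norm_num : (1 : ℝ) < 4)
    have hℓ : (0 : ℝ) < invSide d n := by exact_mod_cast invSide_pos d n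
    refine ⟨n, ?_⟩
    rw [div_le_iff₀ hℓ, mul_comm, ← div_le_iff₀ hr']
    refine hn.le.trans ?_
    exact_mod_cast four_pow_le_invSide hd n
  classical
  obtain ⟨m, hm⟩ : ∃ m, Nat.find hex = m + 1 := by
    refine Nat.exists_eq_succ_of_ne_zero fun h0 => ?_
    have := Nat.find_spec hex
    rw [h0] at this
    simp only [invSide, Nat.cast_one, div_one] at this
    linarith
  have h1 : (d : ℝ) / invSide d (m + 1) ≤ r := hm ▸ Nat.find_spec hex
  have h2 : (r : ℝ) < d / invSide d m := not_le.mp (Nat.find_min hex (by omega))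
  have hℓ : (0 : ℝ) < invSide d m := by exact_mod_cast invSide_pos d m
  have hlogℓ : Real.log (invSide d m) ≤ Real.log d + Real.log (1 / r) := by
    rw [← Real.log_mul hd'.ne' (by positivity)]
    refine Real.log_le_log hℓ ?_
    rw [lt_div_iff₀ hℓ] at h2
    rw [mul_one_div, le_div_iff₀ hr']
    linarith
  have hlog2 := Real.log_two_gt_d9
  have hlog2' := Real.log_two_lt_d9
  have hm2 : (m : ℝ) ^ 2 * Real.log 2 ≤ Real.log (invSide d m) := by
    have h := Real.log_le_log (by positivity)
      (show ((2 ^ m ^ 2 : ℕ) : ℝ) ≤ invSide d m by exact_mod_cast two_pow_le_invSide hd m)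
    push_cast at h
    rw [Real.log_pow] at h
    push_cast at h
    exact h
  have hm : (m : ℝ) ≤ √(2 * (Real.log d + Real.log (1 / r))) := by
    refine Real.le_sqrt_of_sq_le ?_
    nlinarith [sq_nonneg (m : ℝ)]
  set N := (Metric.externalCoveringNumber r (limitSet k)).toNat
  have hN : N ≤ 4 ^ (m + 1) * invSide d (m + 1) ^ (d - 1) :=
    (ENat.toNat_le_of_le_natCast (externalCoveringNumber_limitSet_le (m + 1) h1)).trans
      (card_idx_le hd _)
  have hlogN : Real.log N ≤ Real.log (4 ^ (m + 1) * (invSide d (m + 1) : ℝ) ^ (d - 1)) := by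
    have hpos := invSide_pos d (m + 1)
    rcases Nat.eq_zero_or_pos N with h0 | h0
    · rw [h0, Nat.cast_zero, Real.log_zero]
      refine Real.log_nonneg ?_
      exact_mod_cast Nat.mul_pos (pow_pos four_pos _) (pow_pos hpos (d - 1))
    · refine Real.log_le_log (by exact_mod_cast h0) ?_
      exact_mod_cast hN
  have hℓ' : (0 : ℝ) < invSide d (m + 1) := by exact_mod_cast invSide_pos d (m + 1)
  have hsucc : Real.log (invSide d (m + 1)) =
      Real.log (invSide d m) + (2 + (m + 1) * d) * Real.log 2 := by
    rw [invSide_succ hd]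
    push_cast
    rw [Real.log_mul hℓ.ne' (by positivity), Real.log_pow]
    push_cast
    ring
  have hlog4 : Real.log 4 = 2 * Real.log 2 := by
    rw [show (4 : ℝ) = 2 ^ 2 by norm_num, Real.log_pow]; norm_num
  rw [Real.log_mul (by positivity) (by positivity), Real.log_pow, Real.log_pow, hsucc, hlog4]
    at hlogN
  push_cast at hlogN
  refine hlogN.trans ?_
  set e : ℝ := ((d - 1 : ℕ) : ℝ) with he
  have he0 : 0 ≤ e := Nat.cast_nonneg _
  set y := √(2 * (Real.log d + Real.log (1 / r)))
  calc (m + 1 : ℝ) * (2 * Real.log 2) + e * (Real.log (invSide d m) +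
        (2 + (m + 1) * d) * Real.log 2)
      ≤ (y + 1) * (2 * 1) + e * ((Real.log d + Real.log (1 / r)) + (2 + (y + 1) * d) * 1) := by
        have hL0 : 0 ≤ Real.log 2 := by linarith
        have hL1 : Real.log 2 ≤ 1 := by linarith
        have hy0 : 0 ≤ y := Real.sqrt_nonneg _
        refine add_le_add (mul_le_mul (by linarith) (by linarith) (by positivity) (by positivity))
          (mul_le_mul_of_nonneg_left (add_le_add hlogℓ (mul_le_mul ?_ hL1 hL0 (by positivity))) he0)
        gcongr
    _ = _ := by ring

lemma tendsto_add_mul_sqrt_div (e a b c : ℝ) :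
    Tendsto (fun x : ℝ => (e * x + (a + b * √(2 * (c + x)))) / x) atTop (𝓝 e) := by
  have h1 : Tendsto (fun x : ℝ => 2 * (c * x⁻¹ + 1) * x⁻¹) atTop (𝓝 (2 * (c * 0 + 1) * 0)) :=
    ((((tendsto_inv_atTop_zero).const_mul c).add_const 1).const_mul 2).mul tendsto_inv_atTop_zero
  have h2 := ((tendsto_inv_atTop_zero (𝕜 := ℝ)).const_mul a).add
    ((h1.sqrt).const_mul b) |>.const_add e
  simp only [mul_zero, Real.sqrt_zero, add_zero] at h2
  refine h2.congr' ?_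
  filter_upwards [eventually_gt_atTop 0] with x hx
  have h3 : √(2 * (c * x⁻¹ + 1) * x⁻¹) = √(2 * (c + x)) / x := by
    rw [← Real.sqrt_sq hx.le, ← Real.sqrt_div' _ (sq_nonneg x), Real.sqrt_sq hx.le]
    congr 1
    field_simp
  rw [h3]
  field_simp

lemma tendsto_log_one_div_nnreal :
    Tendsto (fun r : ℝ≥0 => Real.log (1 / (r : ℝ))) (𝓝[>] 0) atTop := by
  refine Real.tendsto_log_atTop.comp ?_
  simp_rw [one_div]
  refine tendsto_inv_nhdsGT_zero.comp ?_
  refine tendsto_nhdsWithin_iff.mpr ⟨?_, ?_⟩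
  · exact (NNReal.continuous_coe.tendsto' 0 0 rfl).mono_left nhdsWithin_le_nhds
  · filter_upwards [self_mem_nhdsWithin] with r hr using hr

theorem hasBoxDim_limitSet (hd : 2 ≤ d) (hnull : ¬ IsTubeNull (limitSet k)) :
    HasBoxDim (limitSet k) ((d : ℝ) - 1) := by
  refine ⟨nonempty_of_not_isTubeNull hnull, isBounded_limitSet, ?_⟩
  have hd1 : (d : ℝ) - 1 = (d - 1 : ℕ) := by rw [Nat.cast_sub (by omega)]; norm_num
  rw [hd1]
  obtain ⟨δ, hδ, h⟩ := exists_le_coveringNumber_of_not_isTubeNull (by omega) hnull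
  have hupper := (tendsto_add_mul_sqrt_div (d - 1 : ℕ) (2 + (d - 1 : ℕ) * (Real.log d + 2 + d))
    (2 + (d - 1 : ℕ) * d) (Real.log d)).comp tendsto_log_one_div_nnreal
  have hlower := (tendsto_add_mul_sqrt_div (d - 1 : ℕ) (Real.log δ - (d - 1 : ℕ) * Real.log 2)
    0 0).comp tendsto_log_one_div_nnreal
  have hsmall : ∀ᶠ r : ℝ≥0 in 𝓝[>] 0, r < 1 :=
    mem_nhdsWithin_of_mem_nhds (Iio_mem_nhds one_pos)
  have hd' : (2 : ℝ) ≤ d := by exact_mod_cast hd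
  refine tendsto_of_tendsto_of_tendsto_of_le_of_le' hlower hupper ?_ ?_
  · filter_upwards [self_mem_nhdsWithin, hsmall] with r hr hr1
    have hr0 : (0 : ℝ) < r := hr
    have hr1' : (r : ℝ) < 1 := hr1
    have hx : 0 ≤ Real.log (1 / (r : ℝ)) := Real.log_nonneg (by
      rw [le_div_iff₀ hr0]; linarith)
    -- Finiteness is needed because `toNat` sends `⊤` to `0`.
    have hfin : Metric.externalCoveringNumber r (limitSet k) ≠ ⊤ := by
      obtain ⟨n, hn⟩ := pow_unbounded_of_one_lt ((d : ℝ) / r) (by norm_num : (1 : ℝ) < 4)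
      have hℓ : (0 : ℝ) < invSide d n := by exact_mod_cast invSide_pos d n
      refine ne_top_of_le_ne_top (ENat.natCast_ne_top _) (externalCoveringNumber_limitSet_le n ?_)
      rw [div_le_iff₀ hℓ, mul_comm, ← div_le_iff₀ hr0]
      refine hn.le.trans ?_
      exact_mod_cast four_pow_le_invSide hd n
    have h1 := h r hr hfin
    have hN : (0 : ℝ) < (Metric.externalCoveringNumber r (limitSet k)).toNat := by
      by_contra! h0
      have : ((Metric.externalCoveringNumber r (limitSet k)).toNat : ℝ) * (2 * r) ^ (d - 1) ≤ 0 :=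
        mul_nonpos_of_nonpos_of_nonneg h0 (by positivity)
      linarith
    have h2 := Real.log_le_log hδ h1
    rw [Real.log_mul hN.ne' (by positivity), Real.log_pow, Real.log_mul two_ne_zero hr0.ne'] at h2
    simp only [Function.comp_apply, zero_mul, add_zero]
    gcongr
    rw [one_div, Real.log_inv]
    linarith
  · filter_upwards [self_mem_nhdsWithin, hsmall] with r hr hr1
    have hr0 : (0 : ℝ) < r := hr
    have hr1' : (r : ℝ) < 1 := hr1
    have hx : 0 ≤ Real.log (1 / (r : ℝ)) := Real.log_nonneg (by
      rw [le_div_iff₀ hr0]; linarith)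
    simp only [Function.comp_apply]
    gcongr
    exact log_coveringNumber_limitSet_le hd hr (by linarith)

end

theorem theorem1p1 (d : ℕ) (hd : 2 ≤ d) :
    ∃ A : Set (EuclideanSpace ℝ (Fin d)),
      IsPurelyUnrectifiable A ∧
      dimH A = ((d - 1 : ℕ) : ℝ≥0∞) ∧
      HasBoxDim A ((d : ℝ) - 1) ∧
      ¬ IsTubeNull A := by
  obtain ⟨k, B, h0, h1, hB⟩ := exists_cubes hd
  have hk : IsRefining k := ⟨h0, h1⟩
  have hnull := hk.not_isTubeNull_limitSet hd hB
  exact ⟨limitSet k, hk.isPurelyUnrectifiable_limitSet,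
    (dimH_limitSet_le hd).antisymm (le_dimH_of_not_isTubeNull hd hnull),
    hasBoxDim_limitSet hd hnull, hnull⟩
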